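/- Let $n\ge 1$. All functions are Lebesgue measurable, $f^*(t)=\inf\{y>0: |\{|f|>y\}|\le t\}$ is the nonincreasing rearrangement of $f$, and $f^{**}(t)=\frac1t\int_0^t f^*(\tau)\,d\tau$ ($t>0$). A rearrangement-invariant space (RIS) on $\mathbb R^n$ is a Banach function space (with the Fatou property) whose function norm satisfies $\|f\|\le\|g\|$ whenever $f^*\le g^*$; the associate norm of $X$ is $\|g\|_{X'}=\sup\{\int_{\mathbb R^n}|fg|\,dx:\ \|f\|_X\le 1\}\in[0,\infty]$. Let $\Phi\in B_n(\infty)$, i.e. $\Phi:(0,\infty)\to(0,\infty)$ is nonincreasing and continuous, and for some $C>0$ we have $\int_0^r\Phi(\rho)\rho^{n-1}\,d\rho\le C\,\Phi(r)r^n$ for all $r>0$. Let $E$ be an RIS on $\mathbb R^n$, let $(M_\Phi f)(x)=\sup_{r>0}\Phi(r)\int_{B(x,r)}|f(y)|\,dy$, and let $M_E^\Phi=\{M_\Phi f: f\in E\}$ with $\|u\|_{M_E^\Phi}=\inf\{\|f\|_E: f\in E,\ M_\Phi f=u\}$. For an RIS $X$, the embedding $M_E^\Phi\hookrightarrow X$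 means that $M_E^\Phi\subset X$ and $\|u\|_X\le C\|u\|_{M_E^\Phi}$ for all $u\in M_E^\Phi$, with a constant $C$ independent of $u$. An RIS $X_0$ is optimal for this embedding if $M_E^\Phi\hookrightarrow X_0$, and $X_0\subset X$ for every RIS $X$ with $M_E^\Phi\hookrightarrow X$. Let $X_0$ be an optimal RIS for this embedding. Then, up to equivalence of norms, $$\|g\|_{X_0'}\;\cong\;N(g):=\sup_{f\in E,\ \|f\|_E\ne0}\ \frac{\displaystyle\int_0^\infty g^*(\tau)\sup_{\tau<t<\infty}\Phi(t^{1/n})\,t\,f^{**}(t)\,d\tau}{\|f\|_E}.$$ Precisely: 1. there are constants $c,C>0$ such that $c\,N(g)\le\|g\|_{X_0'}\le C\,N(g)$ for every measurable $g:\mathbb R^n\to\mathbb C$ (with values in $[0,\infty]$); 2. $X_0$ has an equivalent rearrangement-invariant function norm whose associate norm is exactly $N$, i.e. $\|g\|_{X_0'}=N(g)$ for every measurable $g$ when $X_0$ carries this norm. -/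

import Mathlib

open MeasureTheory Set Filter Topology
open scoped ENNReal NNReal

namespace FracMax

/-- The nonincreasing rearrangement `w*(t) = inf {y > 0 : μ {w > y} ≤ t}` (`t > 0`) of a
nonnegative extended-real function; for a complex-valued `f` it is applied to `|f|`. The value
`y = ∞` is always admissible, so the infimum is `∞` when no finite `y` qualifies. -/
noncomputable def rearr {α : Type*} [MeasurableSpace α] (μ : Measure α) (w : α → ℝ≥0∞) (t : ℝ) :
    ℝ≥0∞ :=
  sInf {y : ℝ≥0∞ | 0 < y ∧ μ {x | y < w x} ≤ ENNReal.ofReal t}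

/-- The averaged rearrangement `w**(t) = (1/t) ∫₀ᵗ w*(τ) dτ` (`t > 0`). -/
noncomputable def rearrAvg {α : Type*} [MeasurableSpace α] (μ : Measure α) (w : α → ℝ≥0∞) (t : ℝ) :
    ℝ≥0∞ :=
  (∫⁻ τ in Ioo 0 t, rearr μ w τ) / ENNReal.ofReal t

/-- A rearrangement-invariant space on `ℝⁿ` with Lebesgue measure, given by its
rearrangement-invariant function norm `ρ`, a functional on nonnegative measurable functions.
The functions may take the value `∞`; a function with finite norm is finite a.e. by
`local_integrable`. Only the values of `ρ` on (a.e.-)measurable functions matter. -/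
structure RIS (n : ℕ) where
  /-- the function norm -/
  ρ : (EuclideanSpace ℝ (Fin n) → ℝ≥0∞) → ℝ≥0∞
  eq_zero_iff : ∀ f, AEMeasurable f volume → (ρ f = 0 ↔ f =ᵐ[volume] 0)
  smul : ∀ (a : ℝ≥0) f, AEMeasurable f volume → ρ (fun x => (a : ℝ≥0∞) * f x) = a * ρ f
  add_le : ∀ f g, AEMeasurable f volume → AEMeasurable g volume →
    ρ (fun x => f x + g x) ≤ ρ f + ρ g
  mono : ∀ f g, AEMeasurable f volume → AEMeasurable g volume → f ≤ᵐ[volume] g → ρ f ≤ ρ g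
  fatou : ∀ (F : ℕ → EuclideanSpace ℝ (Fin n) → ℝ≥0∞) (f : EuclideanSpace ℝ (Fin n) → ℝ≥0∞),
    (∀ k, AEMeasurable (F k) volume) → AEMeasurable f volume →
    (∀ k, F k ≤ᵐ[volume] F (k + 1)) →
    (∀ᵐ x ∂volume, Tendsto (fun k => F k x) atTop (𝓝 (f x))) →
    Tendsto (fun k => ρ (F k)) atTop (𝓝 (ρ f))
  local_integrable : ∀ s : Set (EuclideanSpace ℝ (Fin n)), MeasurableSet s →
    0 < volume s → volume s < ∞ →
    ∃ c : ℝ≥0, ∀ f, AEMeasurable f volume → ∫⁻ x in s, f x ≤ c * ρ f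
  indicator_lt_top : ∀ s : Set (EuclideanSpace ℝ (Fin n)), MeasurableSet s →
    0 < volume s → volume s < ∞ → ρ (s.indicator 1) < ∞
  rearr_mono : ∀ f g, AEMeasurable f volume → AEMeasurable g volume →
    (∀ t : ℝ, 0 < t → rearr volume f t ≤ rearr volume g t) → ρ f ≤ ρ g

namespace RIS

variable {n : ℕ}

/-- The norm `‖f‖_X = ρ(|f|)`, for functions with values in `ℂ` or in `[0, ∞]`. -/
noncomputable def norm (X : RIS n) {F : Type*} [ENorm F]
    (f : EuclideanSpace ℝ (Fin n) → F) : ℝ≥0∞ :=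
  X.ρ (fun x => ‖f x‖ₑ)

/-- Membership `f ∈ X`: `f` is measurable and `‖f‖_X < ∞`. -/
def Mem (X : RIS n) {F : Type*} [ENorm F] [MeasurableSpace F]
    (f : EuclideanSpace ℝ (Fin n) → F) : Prop :=
  AEMeasurable f volume ∧ X.norm f < ∞

/-- The associate norm `‖g‖_{X'} = sup { ∫ |f g| : ‖f‖_X ≤ 1 }`. -/
noncomputable def assocNorm (X : RIS n) (g : EuclideanSpace ℝ (Fin n) → ℂ) : ℝ≥0∞ :=
  ⨆ (f : EuclideanSpace ℝ (Fin n) → ℂ) (_ : X.Mem f) (_ : X.norm f ≤ 1),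
    ∫⁻ x, ‖f x * g x‖ₑ

/-- `X` and `Y` have equivalent function norms. -/
def Equivalent (X Y : RIS n) : Prop :=
  ∃ c C : ℝ≥0, 0 < c ∧ 0 < C ∧ ∀ f : EuclideanSpace ℝ (Fin n) → ℝ≥0∞, AEMeasurable f volume →
    c * X.ρ f ≤ Y.ρ f ∧ Y.ρ f ≤ C * X.ρ f

end RIS

/-- The class `B_n(∞)`: positive nonincreasing continuous functions `Φ` on `(0, ∞)` with
`∫₀ʳ Φ(ρ) ρⁿ⁻¹ dρ ≤ C Φ(r) rⁿ` for all `r > 0`. -/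
structure ClassB (n : ℕ) (Φ : ℝ → ℝ) : Prop where
  pos : ∀ r, 0 < r → 0 < Φ r
  anti : AntitoneOn Φ (Ioi 0)
  cont : ContinuousOn Φ (Ioi 0)
  integral_le : ∃ C : ℝ, 0 < C ∧ ∀ r : ℝ, 0 < r →
    ∫⁻ s in Ioo 0 r, ENNReal.ofReal (Φ s * s ^ (n - 1)) ≤ ENNReal.ofReal (C * Φ r * r ^ n)

/-- The generalized fractional maximal function
`(M_Φ f)(x) = sup_{r > 0} Φ(r) ∫_{B(x,r)} |f|`, with values in `[0, ∞]`. -/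
noncomputable def maximalFn {n : ℕ} (Φ : ℝ → ℝ) (f : EuclideanSpace ℝ (Fin n) → ℂ)
    (x : EuclideanSpace ℝ (Fin n)) : ℝ≥0∞ :=
  ⨆ (r : ℝ) (_ : 0 < r), ENNReal.ofReal (Φ r) * ∫⁻ y in Metric.ball x r, ‖f y‖ₑ

/-- The space `M_E^Φ` of generalized fractional maximal functions: all `M_Φ f` with `f ∈ E`. -/
def maximalSpace {n : ℕ} (Φ : ℝ → ℝ) (E : RIS n) : Set (EuclideanSpace ℝ (Fin n) → ℝ≥0∞) :=
  {u | ∃ f : EuclideanSpace ℝ (Fin n) → ℂ, E.Mem f ∧ maximalFn Φ f = u}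

/-- `‖u‖_{M_E^Φ} = inf { ‖f‖_E : f ∈ E, M_Φ f = u }`. -/
noncomputable def maximalNorm {n : ℕ} (Φ : ℝ → ℝ) (E : RIS n)
    (u : EuclideanSpace ℝ (Fin n) → ℝ≥0∞) : ℝ≥0∞ :=
  ⨅ (f : EuclideanSpace ℝ (Fin n) → ℂ) (_ : E.Mem f) (_ : maximalFn Φ f = u), E.norm f

/-- The embedding `M_E^Φ(ℝⁿ) ↪ X(ℝⁿ)`: inclusion together with a norm estimate. -/
def MaximalEmbeds {n : ℕ} (Φ : ℝ → ℝ) (E X : RIS n) : Prop :=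
  (∀ u ∈ maximalSpace Φ E, X.Mem u) ∧
    ∃ C : ℝ≥0, ∀ u ∈ maximalSpace Φ E, X.norm u ≤ C * maximalNorm Φ E u

/-- `X₀` is an optimal rearrangement-invariant space for the embedding `M_E^Φ ↪ X`: the embedding
holds for `X₀`, and `X₀ ⊆ X` for every rearrangement-invariant `X` for which it holds. -/
def IsOptimal {n : ℕ} (Φ : ℝ → ℝ) (E X₀ : RIS n) : Prop :=
  MaximalEmbeds Φ E X₀ ∧
    ∀ X : RIS n, MaximalEmbeds Φ E X →
      ∀ f : EuclideanSpace ℝ (Fin n) → ℂ, X₀.Mem f → X.Mem f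

/-- The supremal operator `(T_Φ f)(τ) = sup_{τ < t < ∞} Φ(t^{1/n}) t f**(t)`. -/
noncomputable def supOp {n : ℕ} (Φ : ℝ → ℝ) (f : EuclideanSpace ℝ (Fin n) → ℂ) (τ : ℝ) : ℝ≥0∞ :=
  ⨆ (t : ℝ) (_ : τ < t),
    ENNReal.ofReal (Φ (t ^ (1 / (n : ℝ))) * t) * rearrAvg volume (fun x => ‖f x‖ₑ) t

/-- `sup_f ( ∫₀^∞ g*(τ) sup_{τ < t < ∞} Φ(t^{1/n}) t f**(t) dτ ) / ‖f‖_E` over all `f ∈ E` with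
`‖f‖_E ≠ 0`. -/
noncomputable def supFormula {n : ℕ} (Φ : ℝ → ℝ) (E : RIS n)
    (g : EuclideanSpace ℝ (Fin n) → ℂ) : ℝ≥0∞ :=
  ⨆ (f : EuclideanSpace ℝ (Fin n) → ℂ) (_ : E.Mem f) (_ : E.norm f ≠ 0),
    (∫⁻ τ in Ioi (0 : ℝ), rearr volume (fun x => ‖g x‖ₑ) τ * supOp Φ f τ) / E.norm f

end FracMax

/-! The heart of the matter is that `supOp Φ f` describes the rearrangement of fractional maximal
functions. Pointwise, `(M_Φ f)* ≤ K · supOp Φ f` (`exists_rearr_maximalFn_le`: a Vitali covering for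
small radii, Hardy–Littlewood for large ones). Conversely, every `f` with finite rearrangement has a
radially nonincreasing competitor `g` with `g* ≤ f*` and `supOp Φ f ≤ K · (M_Φ g)*`
(`exists_supOp_le_rearr_maximalFn`).

Write `N` for `assocFormula Φ E`, the formula on nonnegative functions. If the embedding holds for
`X`, the lower estimate and Hölder's inequality for rearrangements give `N ≤ A · X'`
(`assocFormula_le_assoc`). Now let `Y` have the norm `sup {∫ f* w* : N w ≤ 1}`. Hardy's lemma makes
it a rearrangement-invariant norm (`dualRIS`); the bound `N ≤ A · X'` makes `N` finite on
indicators, hence `Y` locally integrable. By the upper estimate the embedding holds for `Y`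
(`maximalEmbeds_of_ρ_eq`), and the resonance property of Lebesgue measure gives `Y' = N` with no
loss of constant (`assoc_eq_assocFormula_of_ρ_eq`).

Optimality yields `X₀ ⊆ Y`, and an inclusion of such spaces is automatically bounded
(`RIS.exists_ρ_le_of_mem_imp`). In the other direction, the Lorentz–Luxemburg theorem
(`RIS.ρ_le_iSup_assoc`) recovers the norm of `X₀` from `X₀'`, so `N ≤ A · X₀'` gives `‖f‖_{X₀} ≤ A
‖f‖_Y`. Thus `Y` is an equivalent renorming of `X₀` with associate norm exactly `N`. -/

namespace FracMax

/-! ### Rearrangements: equimeasurability, Hardy–Littlewood, Hardy's lemma. -/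

section Rearrangement

variable {α : Type*} [MeasurableSpace α] {μ : Measure α}

/-- The distribution function is right-continuous, so the infimum is attained (apart from the
constraint `0 < y`). This Galois connection replaces the definition nearly everywhere below. -/
theorem rearr_le_iff {w : α → ℝ≥0∞} {t : ℝ} {y : ℝ≥0∞} :
    rearr μ w t ≤ y ↔ μ {x | y < w x} ≤ ENNReal.ofReal t := by
  constructor
  · intro h
    rcases eq_or_ne y ⊤ with rfl | hy
    · simp
    obtain ⟨u, hu, hu', hlim⟩ := exists_seq_strictAnti_tendsto' (lt_top_iff_ne_top.2 hy)
    have hset : {x | y < w x} = ⋃ k, {x | u k < w x} := by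
      ext x
      simp only [mem_ofPred_eq, mem_iUnion]
      constructor
      · intro hx
        exact (hlim.eventually_lt_const hx).exists
      · rintro ⟨k, hk⟩
        exact (hu' k).1.trans hk
    rw [hset, Monotone.measure_iUnion]
    · refine iSup_le fun k => ?_
      obtain ⟨z, hz, hzk⟩ := sInf_lt_iff.1 (h.trans_lt (hu' k).1)
      exact (measure_mono fun x hx => hzk.trans hx).trans hz.2
    · exact fun i j hij x hx => (hu.antitone hij).trans_lt hx
  · intro h
    refine le_of_forall_gt_imp_ge_of_dense fun z hz => sInf_le ⟨bot_le.trans_lt hz, ?_⟩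
    exact (measure_mono fun x hx => hz.trans hx).trans h

theorem measure_rearr_lt_le (w : α → ℝ≥0∞) (t : ℝ) :
    μ {x | rearr μ w t < w x} ≤ ENNReal.ofReal t :=
  rearr_le_iff.1 le_rfl

theorem lt_rearr_iff {w : α → ℝ≥0∞} {t : ℝ} {y : ℝ≥0∞} :
    y < rearr μ w t ↔ ENNReal.ofReal t < μ {x | y < w x} := by
  rw [← not_le, rearr_le_iff, not_le]

theorem antitone_rearr (w : α → ℝ≥0∞) : Antitone (rearr μ w) := fun _ _ hst =>
  rearr_le_iff.2 ((measure_rearr_lt_le w _).trans (ENNReal.ofReal_le_ofReal hst))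

@[fun_prop]
theorem measurable_rearr (w : α → ℝ≥0∞) : Measurable (rearr μ w) :=
  (antitone_rearr w).measurable

theorem rearr_mono_ae {w v : α → ℝ≥0∞} (h : w ≤ᵐ[μ] v) (t : ℝ) :
    rearr μ w t ≤ rearr μ v t := by
  rw [rearr_le_iff]
  refine le_trans (measure_mono_ae ?_) (measure_rearr_lt_le v t)
  filter_upwards [h] with x hx hx'
  exact lt_of_lt_of_le hx' hx

theorem rearr_congr_ae {w v : α → ℝ≥0∞} (h : w =ᵐ[μ] v) : rearr μ w = rearr μ v :=
  funext fun t => le_antisymm (rearr_mono_ae h.le t) (rearr_mono_ae h.symm.le t)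

theorem rearr_zero (t : ℝ) : rearr μ (fun _ : α => (0 : ℝ≥0∞)) t = 0 := by
  rw [← nonpos_iff_eq_zero, rearr_le_iff]
  simp

theorem rearr_const_mul (a : ℝ≥0) (w : α → ℝ≥0∞) (t : ℝ) :
    rearr μ (fun x => (a : ℝ≥0∞) * w x) t = a * rearr μ w t := by
  rcases eq_or_ne a 0 with rfl | ha
  · simpa using rearr_zero t
  have ha' : (a : ℝ≥0∞) ≠ 0 := by simpa using ha
  have hle : ∀ (b : ℝ≥0∞) (v : α → ℝ≥0∞), b ≠ 0 → b ≠ ⊤ →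
      rearr μ (fun x => b * v x) t ≤ b * rearr μ v t := by
    intro b v hb hb'
    rw [rearr_le_iff]
    refine le_trans (measure_mono fun x hx => ?_) (measure_rearr_lt_le v t)
    exact (ENNReal.mul_lt_mul_iff_right hb hb').1 hx
  refine le_antisymm (hle _ _ ha' ENNReal.coe_ne_top) ?_
  have h := hle (a : ℝ≥0∞)⁻¹ (fun x => a * w x) (by simp) (by simpa using ha)
  simp only [← mul_assoc, ENNReal.inv_mul_cancel ha' ENNReal.coe_ne_top, one_mul] at h
  calc (a : ℝ≥0∞) * rearr μ w t ≤ a * ((a : ℝ≥0∞)⁻¹ * rearr μ (fun x => a * w x) t) := by gcongr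
    _ = _ := by rw [← mul_assoc, ENNReal.mul_inv_cancel ha' ENNReal.coe_ne_top, one_mul]

theorem rearr_iSup_ae {F : ℕ → α → ℝ≥0∞} {f : α → ℝ≥0∞}
    (hF : ∀ k, F k ≤ᵐ[μ] F (k + 1)) (h : ∀ᵐ x ∂μ, f x = ⨆ k, F k x) (t : ℝ) :
    rearr μ f t = ⨆ k, rearr μ (F k) t := by
  have hmono : ∀ᵐ x ∂μ, Monotone fun k => F k x := by
    filter_upwards [ae_all_iff.2 hF] with x hx
    exact monotone_nat_of_le_succ hx
  apply le_antisymm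
  · rw [rearr_le_iff]
    set y := ⨆ k, rearr μ (F k) t with hy
    obtain ⟨s, hs, hsm⟩ : ∃ s : Set α, μ sᶜ = 0 ∧ ∀ x ∈ s, (Monotone fun k => F k x) ∧
        f x = ⨆ k, F k x := by
      refine ⟨_, hmono.and h, fun x hx => hx⟩
    have hle : μ {x | y < f x} ≤ μ (⋃ k, ({x | y < F k x} ∩ s)) := by
      refine measure_mono_ae ?_
      filter_upwards [show ∀ᵐ x ∂μ, x ∈ s from hs] with x hxs hx
      have hx' : y < f x := hx
      rw [(hsm x hxs).2, lt_iSup_iff] at hx'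
      obtain ⟨k, hk⟩ := hx'
      exact mem_iUnion.2 ⟨k, hk, hxs⟩
    refine hle.trans ?_
    rw [Monotone.measure_iUnion]
    · refine iSup_le fun k => (measure_mono inter_subset_left).trans ?_
      exact rearr_le_iff.1 (le_iSup (fun k => rearr μ (F k) t) k)
    · rintro i j hij x ⟨hx, hxs⟩
      exact ⟨lt_of_lt_of_le hx ((hsm x hxs).1 hij), hxs⟩
  · refine iSup_le fun k => rearr_mono_ae ?_ t
    filter_upwards [h] with x hx
    exact hx ▸ le_iSup (fun k => F k x) k

/-- The initial segment of `(0, ∞)` of length `m`. -/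
def initSeg (m : ℝ≥0∞) : Set ℝ := {t | 0 < t ∧ ENNReal.ofReal t < m}

theorem initSeg_top : initSeg ⊤ = Ioi 0 := by
  ext t; simp [initSeg]

theorem initSeg_ofReal (s : ℝ) : initSeg (ENNReal.ofReal s) = Ioo 0 s := by
  ext t
  simp only [initSeg, mem_ofPred_eq, mem_Ioo, and_congr_right_iff]
  intro ht
  rw [ENNReal.ofReal_lt_ofReal_iff_of_nonneg ht.le]

theorem initSeg_eq_Ioo {m : ℝ≥0∞} (hm : m ≠ ⊤) : initSeg m = Ioo 0 m.toReal := by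
  rw [← initSeg_ofReal, ENNReal.ofReal_toReal hm]

theorem measurableSet_initSeg (m : ℝ≥0∞) : MeasurableSet (initSeg m) := by
  refine (measurableSet_lt measurable_const measurable_id).inter ?_
  exact measurableSet_lt ENNReal.measurable_ofReal measurable_const

theorem initSeg_subset (m : ℝ≥0∞) : initSeg m ⊆ Ioi 0 := fun _ ht => ht.1

theorem volume_initSeg (m : ℝ≥0∞) : volume (initSeg m) = m := by
  rcases eq_or_ne m ⊤ with rfl | hm
  · simp [initSeg_top]
  · rw [initSeg_eq_Ioo hm]; simp [hm]

theorem initSeg_inter (m m' : ℝ≥0∞) : initSeg m ∩ initSeg m' = initSeg (min m m') := by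
  ext t; simp only [initSeg, mem_inter_iff, mem_ofPred_eq, lt_min_iff]; tauto

theorem initSeg_mono {m m' : ℝ≥0∞} (h : m ≤ m') : initSeg m ⊆ initSeg m' :=
  fun _ ht => ⟨ht.1, ht.2.trans_le h⟩

/-- Equimeasurability of `w` and `w*`, in the strong form that superlevel sets of `w*` are initial
segments. -/
theorem setOf_lt_rearr (w : α → ℝ≥0∞) (y : ℝ≥0∞) :
    {t | 0 < t ∧ y < rearr μ w t} = initSeg (μ {x | y < w x}) := by
  ext t; simp [initSeg, lt_rearr_iff]

theorem lintegral_indicator_ofReal_lt (c : ℝ≥0∞) :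
    ∫⁻ y in Ioi (0 : ℝ), {y : ℝ | ENNReal.ofReal y < c}.indicator 1 y = c := by
  have : MeasurableSet {y : ℝ | ENNReal.ofReal y < c} :=
    measurableSet_lt ENNReal.measurable_ofReal measurable_const
  rw [lintegral_indicator_one this, Measure.restrict_apply this]
  refine Eq.trans ?_ (volume_initSeg c)
  congr 1
  ext t; simp [initSeg, and_comm]

/-- Layer cake formula with a density. -/
theorem lintegral_mul_eq_lintegral_setLIntegral [SFinite μ] {f k : α → ℝ≥0∞}
    (hf : AEMeasurable f μ) (hk : AEMeasurable k μ) :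
    ∫⁻ x, f x * k x ∂μ = ∫⁻ y in Ioi (0 : ℝ), ∫⁻ x in {x | ENNReal.ofReal y < f x}, k x ∂μ := by
  wlog hfm : Measurable f generalizing f
  · rw [lintegral_congr_ae (g := fun x => hf.mk f x * k x), this hf.measurable_mk.aemeasurable
      hf.measurable_mk]
    · refine lintegral_congr fun y => setLIntegral_congr ?_
      filter_upwards [hf.ae_eq_mk] with x hx
      refine propext ?_
      change ENNReal.ofReal y < _ ↔ ENNReal.ofReal y < _
      rw [hx]
    · filter_upwards [hf.ae_eq_mk] with x hx
      rw [hx]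
  wlog hkm : Measurable k generalizing k
  · rw [lintegral_congr_ae (g := fun x => f x * hk.mk k x), this hk.measurable_mk.aemeasurable
      hk.measurable_mk]
    · exact lintegral_congr fun y => lintegral_congr_ae (ae_restrict_of_ae hk.ae_eq_mk.symm)
    · filter_upwards [hk.ae_eq_mk] with x hx
      rw [hx]
  have hset : MeasurableSet {p : ℝ × α | ENNReal.ofReal p.1 < f p.2} :=
    measurableSet_lt (by fun_prop) (by fun_prop)
  -- Write `f x` as the length of `{y > 0 : y < f x}` and apply Tonelli.
  calc ∫⁻ x, f x * k x ∂μ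
      = ∫⁻ x, (∫⁻ y in Ioi (0 : ℝ),
          {p : ℝ × α | ENNReal.ofReal p.1 < f p.2}.indicator (fun p => k p.2) (y, x)) ∂μ := by
        refine lintegral_congr fun x => ?_
        conv_lhs => rw [← lintegral_indicator_ofReal_lt (f x)]
        rw [← lintegral_mul_const]
        · refine lintegral_congr fun y => ?_
          by_cases h : ENNReal.ofReal y < f x <;> simp [indicator, h]
        · exact (measurable_one.indicator
            (measurableSet_lt ENNReal.measurable_ofReal measurable_const))
    _ = ∫⁻ y in Ioi (0 : ℝ), ∫⁻ x,
          {p : ℝ × α | ENNReal.ofReal p.1 < f p.2}.indicator (fun p => k p.2) (y, x) ∂μ := by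
        rw [lintegral_lintegral_swap]
        refine Measurable.aemeasurable ?_
        exact ((hkm.comp measurable_snd).indicator hset).comp measurable_swap
    _ = _ := by
        refine lintegral_congr fun y => ?_
        rw [← lintegral_indicator (measurableSet_lt measurable_const hfm)]
        rfl

theorem lintegral_eq_lintegral_meas_ofReal_lt [SFinite μ] {f : α → ℝ≥0∞}
    (hf : AEMeasurable f μ) :
    ∫⁻ x, f x ∂μ = ∫⁻ y in Ioi (0 : ℝ), μ {x | ENNReal.ofReal y < f x} := by
  simpa using lintegral_mul_eq_lintegral_setLIntegral hf (aemeasurable_const (b := 1))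

theorem setOf_inter_Ioi (P : ℝ → Prop) : {t | P t} ∩ Ioi (0 : ℝ) = {t | 0 < t ∧ P t} := by
  ext t; simp [and_comm]

/-- Hardy–Littlewood inequality over a set. -/
theorem setLIntegral_le_rearr [SFinite μ] {k : α → ℝ≥0∞} (hk : AEMeasurable k μ) (A : Set α) :
    ∫⁻ x in A, k x ∂μ ≤ ∫⁻ t in initSeg (μ A), rearr μ k t := by
  rw [lintegral_eq_lintegral_meas_ofReal_lt hk.restrict,
    lintegral_eq_lintegral_meas_ofReal_lt (measurable_rearr k).aemeasurable]
  refine lintegral_mono fun y => ?_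
  rw [Measure.restrict_apply (measurableSet_lt measurable_const (measurable_rearr k))]
  have : {t | ENNReal.ofReal y < rearr μ k t} ∩ initSeg (μ A) =
      initSeg (min (μ {x | ENNReal.ofReal y < k x}) (μ A)) := by
    rw [← initSeg_inter, ← setOf_lt_rearr, ← setOf_inter_Ioi, inter_assoc,
      inter_eq_self_of_subset_right (initSeg_subset (μ A))]
  rw [this, volume_initSeg]
  refine le_min (Measure.restrict_apply_le _ _) ?_
  calc _ ≤ μ.restrict A univ := measure_mono (subset_univ _)
    _ = _ := by simp

/-- Hardy–Littlewood inequality. -/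
theorem lintegral_mul_le_rearr [SFinite μ] {f g : α → ℝ≥0∞} (hf : AEMeasurable f μ)
    (hg : AEMeasurable g μ) :
    ∫⁻ x, f x * g x ∂μ ≤ ∫⁻ t in Ioi (0 : ℝ), rearr μ f t * rearr μ g t := by
  rw [lintegral_mul_eq_lintegral_setLIntegral hf hg, lintegral_mul_eq_lintegral_setLIntegral
    (measurable_rearr f).aemeasurable (measurable_rearr g).aemeasurable]
  refine lintegral_mono fun y => (setLIntegral_le_rearr hg _).trans_eq ?_
  rw [Measure.restrict_restrict (measurableSet_lt measurable_const (measurable_rearr f)),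
    setOf_inter_Ioi, setOf_lt_rearr]

theorem lintegral_rearr_tsub [SFinite μ] {w : α → ℝ≥0∞} (hw : AEMeasurable w μ) (y : ℝ≥0∞) :
    ∫⁻ t in Ioi (0 : ℝ), (rearr μ w t - y) = ∫⁻ x, (w x - y) ∂μ := by
  rw [lintegral_eq_lintegral_meas_ofReal_lt (hw.sub_const y),
    lintegral_eq_lintegral_meas_ofReal_lt ((measurable_rearr w).sub_const y).aemeasurable]
  refine lintegral_congr fun z => ?_
  rw [Measure.restrict_apply
    (measurableSet_lt measurable_const ((measurable_rearr w).sub_const y))]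
  simp only [lt_tsub_iff_right]
  rw [setOf_inter_Ioi, setOf_lt_rearr, volume_initSeg]

/-- With `le_setLIntegral_rearr` this is the variational formula `∫₀ˢ w* = min_y (∫ (w - y)₊ + y
s)`, the minimum being attained at `y = w*(s)`. -/
theorem setLIntegral_rearr_le [SFinite μ] {w : α → ℝ≥0∞} (hw : AEMeasurable w μ) (y : ℝ≥0∞)
    (s : ℝ) : ∫⁻ t in Ioo 0 s, rearr μ w t ≤ (∫⁻ x, (w x - y) ∂μ) + y * ENNReal.ofReal s := by
  calc ∫⁻ t in Ioo 0 s, rearr μ w t ≤ ∫⁻ t in Ioo 0 s, (rearr μ w t - y + y) :=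
        lintegral_mono fun t => le_tsub_add
    _ = (∫⁻ t in Ioo 0 s, (rearr μ w t - y)) + y * ENNReal.ofReal s := by
        rw [lintegral_add_right _ measurable_const]; simp
    _ ≤ (∫⁻ t in Ioi (0 : ℝ), (rearr μ w t - y)) + y * ENNReal.ofReal s := by
        gcongr; exact Ioo_subset_Ioi_self
    _ = _ := by rw [lintegral_rearr_tsub hw]

theorem le_setLIntegral_rearr [SFinite μ] {w : α → ℝ≥0∞} (hw : AEMeasurable w μ)
    (s : ℝ) : (∫⁻ x, (w x - rearr μ w s) ∂μ) + rearr μ w s * ENNReal.ofReal s ≤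
      ∫⁻ t in Ioo 0 s, rearr μ w t := by
  set y := rearr μ w s
  have h1 : ∫⁻ t in Ioi (0 : ℝ), (rearr μ w t - y) = ∫⁻ t in Ioo 0 s, (rearr μ w t - y) := by
    rw [← lintegral_indicator measurableSet_Ioi, ← lintegral_indicator measurableSet_Ioo]
    refine lintegral_congr fun t => ?_
    by_cases h0 : 0 < t
    · by_cases hs : t < s
      · simp [indicator, h0, hs]
      · simp [indicator, h0, hs, tsub_eq_zero_of_le (antitone_rearr w (not_lt.1 hs)), y]
    · simp [indicator, h0]
  rw [← lintegral_rearr_tsub hw, h1]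
  have h2 : y * ENNReal.ofReal s = ∫⁻ t in Ioo 0 s, y := by simp
  rw [h2, ← lintegral_add_right _ measurable_const]
  refine setLIntegral_mono' measurableSet_Ioo fun t ht => ?_
  rw [tsub_add_cancel_of_le (antitone_rearr w ht.2.le)]

/-- Test the variational formula for `f + g` with the level `f*(s) + g*(s)`; the truncated excess
`(·)₊` is subadditive. -/
theorem setLIntegral_rearr_add_le [SFinite μ] {f g : α → ℝ≥0∞} (hf : AEMeasurable f μ)
    (hg : AEMeasurable g μ) (s : ℝ) :
    ∫⁻ t in Ioo 0 s, rearr μ (fun x => f x + g x) t ≤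
      (∫⁻ t in Ioo 0 s, rearr μ f t) + ∫⁻ t in Ioo 0 s, rearr μ g t := by
  refine le_trans ?_ (add_le_add (le_setLIntegral_rearr hf s) (le_setLIntegral_rearr hg s))
  refine (setLIntegral_rearr_le (hf.add hg) (rearr μ f s + rearr μ g s) s).trans ?_
  calc (∫⁻ x, (f x + g x - (rearr μ f s + rearr μ g s)) ∂μ) +
        (rearr μ f s + rearr μ g s) * ENNReal.ofReal s
      ≤ (∫⁻ x, ((f x - rearr μ f s) + (g x - rearr μ g s)) ∂μ) +
        (rearr μ f s + rearr μ g s) * ENNReal.ofReal s := by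
        gcongr with x
        exact add_tsub_add_le_tsub_add_tsub
    _ = _ := by
        rw [lintegral_add_left' (hf.sub_const _)]
        ring

theorem setLIntegral_initSeg_rearr_add_le [SFinite μ] {f g : α → ℝ≥0∞} (hf : AEMeasurable f μ)
    (hg : AEMeasurable g μ) (m : ℝ≥0∞) :
    ∫⁻ t in initSeg m, rearr μ (fun x => f x + g x) t ≤
      (∫⁻ t in initSeg m, rearr μ f t) + ∫⁻ t in initSeg m, rearr μ g t := by
  rcases eq_or_ne m ⊤ with rfl | hm
  · have hU : initSeg ⊤ = ⋃ k : ℕ, Ioo (0 : ℝ) k := by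
      rw [initSeg_top]
      ext t
      simp only [mem_Ioi, mem_iUnion, mem_Ioo, exists_and_left]
      exact ⟨fun h => ⟨h, exists_nat_gt t⟩, fun h => h.1⟩
    have hd : Directed (· ⊆ ·) fun k : ℕ => Ioo (0 : ℝ) k :=
      Monotone.directed_le fun i j hij => Ioo_subset_Ioo_right (by exact_mod_cast hij)
    rw [hU, setLIntegral_iUnion_of_directed _ hd]
    refine iSup_le fun k => (setLIntegral_rearr_add_le hf hg k).trans ?_
    gcongr <;> exact subset_iUnion (fun k : ℕ => Ioo (0 : ℝ) k) k
  · rw [initSeg_eq_Ioo hm]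
    exact setLIntegral_rearr_add_le hf hg _

/-- The right endpoint may or may not belong to the set, whence equality only almost everywhere.
Applied to the superlevel sets of a nonincreasing weight. -/
theorem ae_eq_initSeg_of_isLower {A : Set ℝ} (hA : A ⊆ Ioi 0)
    (h : ∀ s ∈ A, ∀ t, 0 < t → t ≤ s → t ∈ A) : ∃ m, A =ᵐ[volume] initSeg m := by
  by_cases hb : BddAbove A
  · rcases A.eq_empty_or_nonempty with rfl | hne
    · exact ⟨0, by simp [initSeg]⟩
    refine ⟨ENNReal.ofReal (sSup A), ?_⟩
    rw [initSeg_ofReal]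
    have h1 : Ioo 0 (sSup A) ⊆ A := fun t ht => by
      obtain ⟨s, hs, hts⟩ := exists_lt_of_lt_csSup hne ht.2
      exact h s hs t ht.1 hts.le
    have h2 : A ⊆ Ioc 0 (sSup A) := fun t ht => ⟨hA ht, le_csSup hb ht⟩
    exact (h2.eventuallyLE.trans Ioo_ae_eq_Ioc.symm.le).antisymm h1.eventuallyLE
  · refine ⟨⊤, ?_⟩
    rw [initSeg_top]
    refine (hA.antisymm fun t ht => ?_).eventuallyEq
    obtain ⟨s, hs, hts⟩ := not_bddAbove_iff.1 hb t
    exact h s hs t ht hts.le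

/-- Hardy's lemma for sums of rearrangements. -/
theorem lintegral_rearr_add_mul_le [SFinite μ] {f g : α → ℝ≥0∞} (hf : AEMeasurable f μ)
    (hg : AEMeasurable g μ) {ψ : ℝ → ℝ≥0∞} (hψ : AntitoneOn ψ (Ioi 0)) :
    ∫⁻ t in Ioi (0 : ℝ), rearr μ (fun x => f x + g x) t * ψ t ≤
      (∫⁻ t in Ioi (0 : ℝ), rearr μ f t * ψ t) + ∫⁻ t in Ioi (0 : ℝ), rearr μ g t * ψ t := by
  have hψm : AEMeasurable ψ (volume.restrict (Ioi (0 : ℝ))) :=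
    aemeasurable_restrict_of_antitoneOn measurableSet_Ioi hψ
  have hseg : ∀ y : ℝ, ∃ m, (volume.restrict (Ioi (0 : ℝ))).restrict
      {t | ENNReal.ofReal y < ψ t} = volume.restrict (initSeg m) := by
    intro y
    obtain ⟨m, hm⟩ := ae_eq_initSeg_of_isLower (A := {t | 0 < t ∧ ENNReal.ofReal y < ψ t})
      (fun t ht => ht.1) (fun s hs t ht hts => ⟨ht, hs.2.trans_le (hψ ht hs.1 hts)⟩)
    refine ⟨m, ?_⟩
    rw [Measure.restrict_restrict', setOf_inter_Ioi, Measure.restrict_congr_set hm]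
    exact measurableSet_Ioi
  -- Slicing the weight `ψ` by levels reduces the claim to initial segments.
  have key : ∀ w : α → ℝ≥0∞, ∫⁻ t in Ioi (0 : ℝ), rearr μ w t * ψ t =
      ∫⁻ y in Ioi (0 : ℝ), ∫⁻ t in {t | ENNReal.ofReal y < ψ t}, rearr μ w t
        ∂(volume.restrict (Ioi (0 : ℝ))) := by
    intro w
    rw [← lintegral_mul_eq_lintegral_setLIntegral hψm (measurable_rearr w).aemeasurable]
    simp only [mul_comm]
  have hanti : ∀ w : α → ℝ≥0∞, Antitone fun y : ℝ => ∫⁻ t in {t | ENNReal.ofReal y < ψ t},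
      rearr μ w t ∂(volume.restrict (Ioi (0 : ℝ))) := fun w y z hyz =>
    lintegral_mono_set fun t ht => (ENNReal.ofReal_le_ofReal hyz).trans_lt ht
  rw [key, key, key, ← lintegral_add_left (hanti f).measurable]
  refine lintegral_mono fun y => ?_
  obtain ⟨m, hm⟩ := hseg y
  simp only [hm]
  exact setLIntegral_initSeg_rearr_add_le hf hg m

theorem lintegral_rearr_iSup_mul {F : ℕ → α → ℝ≥0∞} {f : α → ℝ≥0∞}
    (hF : ∀ k, F k ≤ᵐ[μ] F (k + 1)) (h : ∀ᵐ x ∂μ, f x = ⨆ k, F k x) {ψ : ℝ → ℝ≥0∞}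
    (hψ : AEMeasurable ψ (volume.restrict (Ioi (0 : ℝ)))) :
    ∫⁻ t in Ioi (0 : ℝ), rearr μ f t * ψ t = ⨆ k, ∫⁻ t in Ioi (0 : ℝ), rearr μ (F k) t * ψ t := by
  rw [← lintegral_iSup' (f := fun k t => rearr μ (F k) t * ψ t)
    (fun k => (measurable_rearr (F k)).aemeasurable.mul hψ)]
  · refine lintegral_congr fun t => ?_
    rw [rearr_iSup_ae hF h, ENNReal.iSup_mul]
  · refine ae_of_all _ fun t => monotone_nat_of_le_succ fun k => ?_
    exact mul_le_mul_left (rearr_mono_ae (hF k) t) _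

theorem rearr_indicator_one (s : Set α) (t : ℝ) :
    rearr μ (s.indicator 1) t = {t | ENNReal.ofReal t < μ s}.indicator 1 t := by
  have hle : ∀ y : ℝ≥0∞, y < 1 → {x | y < s.indicator 1 x} = s := by
    intro y hy
    ext x
    by_cases hx : x ∈ s <;> simp [hx, hy]
  have h1 : rearr μ (s.indicator 1) t ≤ 1 := by
    rw [rearr_le_iff]
    have : {x | (1 : ℝ≥0∞) < s.indicator 1 x} = ∅ := by
      ext x
      by_cases hx : x ∈ s <;> simp [hx]
    simp [this]
  by_cases ht : ENNReal.ofReal t < μ s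
  · rw [indicator_of_mem (by exact ht)]
    refine le_antisymm h1 (le_of_forall_lt fun y hy => ?_)
    rw [lt_rearr_iff, hle y hy]
    exact ht
  · rw [indicator_of_notMem (by exact ht), ← nonpos_iff_eq_zero, rearr_le_iff,
      hle 0 zero_lt_one]
    exact not_lt.1 ht

theorem lintegral_rearr_indicator_one_mul (s : Set α) (ψ : ℝ → ℝ≥0∞) :
    ∫⁻ t in Ioi (0 : ℝ), rearr μ (s.indicator 1) t * ψ t = ∫⁻ t in initSeg (μ s), ψ t := by
  have hm : MeasurableSet {t | ENNReal.ofReal t < μ s} :=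
    measurableSet_lt ENNReal.measurable_ofReal measurable_const
  have : initSeg (μ s) = {t | ENNReal.ofReal t < μ s} ∩ Ioi 0 := by
    ext t; simp [initSeg, and_comm]
  rw [this, ← Measure.restrict_restrict hm, ← lintegral_indicator hm]
  refine lintegral_congr fun t => ?_
  rw [rearr_indicator_one]
  by_cases ht : ENNReal.ofReal t < μ s <;> simp [indicator, ht]

end Rearrangement

/-! ### Resonance of Lebesgue measure on `ℝⁿ`. -/

section Resonance

/-- If `v` is positive with null level sets, then `x ↦ ν {v > v x}` pushes `ν` forward to Lebesgue
measure on `(0, ν univ)`. -/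
theorem map_measure_lt_toReal {α : Type*} [MeasurableSpace α] (ν : Measure α) [IsFiniteMeasure ν]
    {v : α → ℝ≥0∞} (hv : Measurable v) (hnull : ∀ y, 0 < y → ν {x | v x = y} = 0)
    (hpos : ∀ᵐ x ∂ν, 0 < v x) :
    Measurable (fun x => (ν {z | v x < v z}).toReal) ∧
    ν.map (fun x => (ν {z | v x < v z}).toReal) = volume.restrict (Ioo 0 (ν univ).toReal) := by
  have hd : Antitone fun y : ℝ≥0∞ => ν {z | y < v z} := fun y y' h =>
    measure_mono fun z hz => h.trans_lt hz
  have hσ : Measurable (fun x => (ν {z | v x < v z}).toReal) :=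
    ENNReal.measurable_toReal.comp (hd.measurable.comp hv)
  refine ⟨hσ, Measure.ext_of_Iic _ _ fun a => ?_⟩
  rw [Measure.map_apply hσ measurableSet_Iic, Measure.restrict_apply measurableSet_Iic]
  rcases lt_or_ge a 0 with ha | ha
  · have h1 : (fun x => (ν {z | v x < v z}).toReal) ⁻¹' Iic a = ∅ := by
      ext x
      simp only [mem_preimage, mem_Iic, mem_empty_iff_false, iff_false, not_le]
      exact ha.trans_le ENNReal.toReal_nonneg
    have h2 : Iic a ∩ Ioo 0 (ν univ).toReal = ∅ := by
      ext x
      simp only [mem_inter_iff, mem_Iic, mem_Ioo, mem_empty_iff_false, iff_false]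
      rintro ⟨h, h', -⟩
      linarith
    rw [h1, h2]
    simp
  have hR : volume (Iic a ∩ Ioo 0 (ν univ).toReal) = min (ENNReal.ofReal a) (ν univ) := by
    rcases lt_or_ge a (ν univ).toReal with h | h
    · have : Iic a ∩ Ioo 0 (ν univ).toReal = Ioc 0 a := by
        ext x
        simp only [mem_inter_iff, mem_Iic, mem_Ioo, mem_Ioc]
        constructor
        · rintro ⟨h1, h2, -⟩; exact ⟨h2, h1⟩
        · rintro ⟨h1, h2⟩; exact ⟨h2, h1, h2.trans_lt h⟩
      rw [this, Real.volume_Ioc, sub_zero, min_eq_left]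
      exact ENNReal.ofReal_le_of_le_toReal h.le
    · have : Iic a ∩ Ioo 0 (ν univ).toReal = Ioo 0 (ν univ).toReal :=
        inter_eq_self_of_subset_right fun x hx => hx.2.le.trans h
      rw [this, Real.volume_Ioo, sub_zero, ENNReal.ofReal_toReal (measure_ne_top _ _), min_eq_right]
      rwa [ENNReal.le_ofReal_iff_toReal_le (measure_ne_top _ _) ha]
  rw [hR]
  set y := rearr ν v a with hy
  have hya : ν {x | y < v x} ≤ ENNReal.ofReal a := rearr_le_iff.1 hy.ge
  have hsub : {x | y < v x} ⊆ (fun x => (ν {z | v x < v z}).toReal) ⁻¹' Iic a := by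
    intro x hx
    refine ENNReal.toReal_le_of_le_ofReal ha (le_trans ?_ hya)
    exact hd (le_of_lt hx)
  -- Null level sets are assumed only at positive heights; at height `0` the positivity of `v` shows
  -- that `a` already exceeds the total mass.
  rcases eq_or_ne y 0 with h0 | h0
  · have hu : ν {x | y < v x} = ν univ := by
      refine le_antisymm (measure_mono (subset_univ _)) (measure_mono_ae ?_)
      filter_upwards [hpos] with x hx _
      rw [h0]; exact hx
    rw [min_eq_right (hu ▸ hya)]
    exact le_antisymm (measure_mono (subset_univ _)) (hu ▸ measure_mono hsub)
  have hy0 : 0 < y := pos_iff_ne_zero.2 h0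
  have hle : ν {x | y ≤ v x} ≤ ν {x | y < v x} := by
    calc ν {x | y ≤ v x} ≤ ν ({x | y < v x} ∪ {x | v x = y}) := measure_mono fun x hx => by
          rcases eq_or_lt_of_le (show y ≤ v x from hx) with h | h
          · exact Or.inr h.symm
          · exact Or.inl h
      _ ≤ ν {x | y < v x} + ν {x | v x = y} := measure_union_le _ _
      _ = _ := by rw [hnull y hy0, add_zero]
  have hge : ENNReal.ofReal a ≤ ν {x | y ≤ v x} := by
    obtain ⟨u, hu, hu', hlim⟩ := exists_seq_strictMono_tendsto' hy0
    have hset : {x | y ≤ v x} = ⋂ k, {x | u k < v x} := by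
      ext x
      simp only [mem_ofPred_eq, mem_iInter]
      constructor
      · exact fun hx k => (hu' k).2.trans_le hx
      · exact fun hx => le_of_tendsto' hlim fun k => (hx k).le
    rw [hset, Antitone.measure_iInter]
    · exact le_iInf fun k => (lt_rearr_iff.1 (hu' k).2).le
    · exact fun i j hij x hx => (hu.monotone hij).trans_lt hx
    · exact fun i => (measurableSet_lt measurable_const hv).nullMeasurableSet
    · exact ⟨0, measure_ne_top _ _⟩
  have hsup : (fun x => (ν {z | v x < v z}).toReal) ⁻¹' Iic a ⊆ {x | y ≤ v x} := by
    intro x hx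
    by_contra hlt
    have h1 : ENNReal.ofReal a < ν {z | v x < v z} := lt_rearr_iff.1 (not_le.1 hlt)
    exact absurd (ENNReal.le_ofReal_iff_toReal_le (measure_ne_top _ _) ha |>.2 hx) (not_le.2 h1)
  have heq : ν {x | y < v x} = ENNReal.ofReal a := le_antisymm hya (hge.trans hle)
  rw [min_eq_left (heq ▸ measure_mono (subset_univ _))]
  refine le_antisymm ((measure_mono hsup).trans (hle.trans hya)) ?_
  rw [← heq]
  exact measure_mono hsub

variable {n : ℕ}

/-- If `g` had null level sets, `σ(x) = |{g > g x}|` would be measure preserving onto an interval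
and `h = ψ ∘ σ` would give equality. A simple `g` has fat level sets, so it is multiplied by a
radial factor `p`, strictly decreasing in `‖x‖` with values in `[1, 1 + ε]`. Each positive level set
of `g p` then lies in a finite union of spheres, at the price of the factor `1 + ε`. -/
theorem exists_rearr_le_lintegral_mul_simpleFunc (hn : 1 ≤ n)
    (g : SimpleFunc (EuclideanSpace ℝ (Fin n)) ℝ≥0∞) (hg : ∀ x, g x < ⊤)
    (hfin : volume {x | 0 < g x} < ⊤) {ψ : ℝ → ℝ≥0∞} (hψ : Antitone ψ) {ε : ℝ} (hε : 0 < ε) :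
    ∃ h : EuclideanSpace ℝ (Fin n) → ℝ≥0∞, Measurable h ∧ (∀ x, h x = 0 ∨ h x ∈ range ψ) ∧
      (∀ t, 0 < t → rearr volume h t ≤ ψ t) ∧
      ∫⁻ t in Ioi (0 : ℝ), rearr volume g t * ψ t ≤ ENNReal.ofReal (1 + ε) * ∫⁻ x, g x * h x := by
  classical
  have : Nonempty (Fin n) := ⟨⟨0, hn⟩⟩
  set S : Set (EuclideanSpace ℝ (Fin n)) := {x | 0 < g x} with hSdef
  have hS : MeasurableSet S := measurableSet_lt measurable_const g.measurable
  set p : EuclideanSpace ℝ (Fin n) → ℝ≥0∞ := fun x => ENNReal.ofReal (1 + ε / (1 + ‖x‖)) with hp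
  have hpm : Measurable p := by fun_prop
  have hp1 : ∀ x, 1 ≤ p x := fun x => by
    rw [hp, ← ENNReal.ofReal_one]
    refine ENNReal.ofReal_le_ofReal ?_
    have : 0 ≤ ε / (1 + ‖x‖) := by positivity
    linarith
  have hp2 : ∀ x, p x ≤ ENNReal.ofReal (1 + ε) := fun x => by
    refine ENNReal.ofReal_le_ofReal ?_
    have : ε / (1 + ‖x‖) ≤ ε := div_le_self hε.le (by linarith [norm_nonneg x])
    linarith
  have hpinj : ∀ x z, p x = p z → ‖x‖ = ‖z‖ := by
    intro x z hxz
    have hx : 0 ≤ 1 + ε / (1 + ‖x‖) := by positivity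
    have hz : 0 ≤ 1 + ε / (1 + ‖z‖) := by positivity
    have h1 := (ENNReal.ofReal_eq_ofReal_iff hx hz).1 hxz
    have h2 : ε / (1 + ‖x‖) = ε / (1 + ‖z‖) := by linarith
    rw [div_eq_div_iff (by positivity) (by positivity)] at h2
    have := mul_left_cancel₀ hε.ne' h2
    linarith
  set v : EuclideanSpace ℝ (Fin n) → ℝ≥0∞ := fun x => g x * p x with hvdef
  have hv : Measurable v := g.measurable.mul hpm
  have : IsFiniteMeasure (volume.restrict S) := ⟨by simpa using hfin⟩
  have hlev : ∀ y, 0 < y → volume.restrict S {x | v x = y} = 0 := by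
    intro y hy
    refine measure_mono_null (t := ⋃ a ∈ g.range, {x | g x = a ∧ v x = y}) ?_ ?_
    · intro x hx
      simp only [mem_iUnion]
      exact ⟨g x, g.mem_range_self x, rfl, hx⟩
    · refine (measure_biUnion_null_iff g.range.countable_toSet).2 fun a _ => ?_
      rcases eq_empty_or_nonempty {x | g x = a ∧ v x = y} with h | ⟨z, hz1, hz2⟩
      · rw [h, measure_empty]
      · refine Measure.absolutelyContinuous_of_le Measure.restrict_le_self ?_
        refine measure_mono_null ?_ (Measure.addHaar_sphere volume 0 ‖z‖)
        rintro x ⟨hx1, hx2⟩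
        rw [mem_sphere_zero_iff_norm]
        apply hpinj
        have ha0 : a ≠ 0 := by
          rintro rfl
          simp only [hvdef, hz1, zero_mul] at hz2
          exact hy.ne hz2
        have ha1 : a ≠ ⊤ := hz1 ▸ (hg z).ne
        have : a * p x = a * p z := by
          simp only [hvdef, hz1] at hz2
          simp only [hvdef, hx1] at hx2
          rw [hx2, hz2]
        exact (ENNReal.mul_right_inj ha0 ha1).1 this
  have hpos : ∀ᵐ x ∂(volume.restrict S), 0 < v x := by
    filter_upwards [ae_restrict_mem hS] with x hx
    exact ENNReal.mul_pos (ne_of_gt hx) (ne_of_gt (zero_lt_one.trans_le (hp1 x)))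
  obtain ⟨hσ, hmap⟩ := map_measure_lt_toReal (volume.restrict S) hv hlev hpos
  set σ : EuclideanSpace ℝ (Fin n) → ℝ := fun x => (volume.restrict S {z | v x < v z}).toReal
    with hσdef
  have hmeas : Measurable (S.indicator (ψ ∘ σ)) := (hψ.measurable.comp hσ).indicator hS
  refine ⟨S.indicator (ψ ∘ σ), hmeas, fun x => ?_, fun t ht => ?_, ?_⟩
  · by_cases hx : x ∈ S
    · exact Or.inr ⟨σ x, by simp [hx]⟩
    · exact Or.inl (by simp [hx])
  · rw [rearr_le_iff]
    calc volume {x | ψ t < S.indicator (ψ ∘ σ) x} ≤ volume (S ∩ σ ⁻¹' Iio t) := by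
          refine measure_mono fun x hx => ?_
          by_cases hxS : x ∈ S
          · refine ⟨hxS, ?_⟩
            have hx' : ψ t < ψ (σ x) := by simpa [hxS] using hx
            exact lt_of_not_ge fun h => (hψ h).not_gt hx'
          · simp [hxS] at hx
      _ = (volume.restrict S).map σ (Iio t) := by
          rw [Measure.map_apply hσ measurableSet_Iio, Measure.restrict_apply
            (hσ measurableSet_Iio), inter_comm]
      _ = volume (Iio t ∩ Ioo 0 (volume.restrict S univ).toReal) := by
          rw [hmap, Measure.restrict_apply measurableSet_Iio]
      _ ≤ volume (Ioo 0 t) := measure_mono fun s hs => ⟨hs.2.1, hs.1⟩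
      _ = _ := by simp
  · have hSuniv : volume.restrict S univ = volume S := by simp
    calc ∫⁻ t in Ioi (0 : ℝ), rearr volume g t * ψ t
        = ∫⁻ t in Ioo 0 (volume S).toReal, rearr volume g t * ψ t := by
          rw [← lintegral_indicator measurableSet_Ioi, ← lintegral_indicator measurableSet_Ioo]
          refine lintegral_congr fun t => ?_
          by_cases h0 : 0 < t
          · by_cases h1 : t < (volume S).toReal
            · simp [indicator, h0, h1]
            · have : rearr volume g t = 0 := by
                rw [← nonpos_iff_eq_zero, rearr_le_iff]
                rw [ENNReal.le_ofReal_iff_toReal_le hfin.ne h0.le]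
                exact not_lt.1 h1
              simp [indicator, h0, h1, this]
          · simp [indicator, h0]
      _ ≤ ∫⁻ t in Ioo 0 (volume S).toReal, rearr (volume.restrict S) v t * ψ t := by
          refine lintegral_mono fun t => mul_le_mul_left ?_ _
          rw [rearr_le_iff]
          refine le_trans (measure_mono fun x hx => ?_)
            ((Measure.le_restrict_apply S _).trans (measure_rearr_lt_le v t))
          have hgv : g x ≤ v x := le_mul_of_one_le_right bot_le (hp1 x)
          exact ⟨lt_of_lt_of_le hx hgv, show 0 < g x from lt_of_le_of_lt bot_le hx⟩
      _ = ∫⁻ t, rearr (volume.restrict S) v t * ψ t ∂((volume.restrict S).map σ) := by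
          rw [hmap, hSuniv]
      _ = ∫⁻ x in S, rearr (volume.restrict S) v (σ x) * ψ (σ x) :=
          lintegral_map ((measurable_rearr v).mul hψ.measurable) hσ
      -- By the choice of `σ`, the set `{v > v x}` has measure exactly `σ x`, so `v*(σ x) ≤ v x`.
      _ ≤ ∫⁻ x in S, v x * ψ (σ x) := by
          refine lintegral_mono fun x => mul_le_mul_left ?_ _
          rw [rearr_le_iff, hσdef, ENNReal.ofReal_toReal (measure_ne_top _ _)]
      _ = ∫⁻ x, v x * S.indicator (ψ ∘ σ) x := by
          rw [← lintegral_indicator hS]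
          refine lintegral_congr fun x => ?_
          by_cases hx : x ∈ S <;> simp [hx]
      _ ≤ ∫⁻ x, ENNReal.ofReal (1 + ε) * (g x * S.indicator (ψ ∘ σ) x) := by
          refine lintegral_mono fun x => ?_
          rw [← mul_assoc, mul_comm (ENNReal.ofReal (1 + ε))]
          gcongr
          exact mul_le_mul_right (hp2 x) _
      _ = _ := lintegral_const_mul _ (g.measurable.mul hmeas)

/-- Resonance: `∫ g* ψ` is approximated by `∫ g h` with `h* ≤ ψ`. -/
theorem exists_rearr_le_lt_lintegral_mul (hn : 1 ≤ n) {g : EuclideanSpace ℝ (Fin n) → ℝ≥0∞}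
    (hg : AEMeasurable g volume) {ψ : ℝ → ℝ≥0∞} (hψ : AntitoneOn ψ (Ioi 0)) {a : ℝ≥0∞}
    (ha : a < ∫⁻ t in Ioi (0 : ℝ), rearr volume g t * ψ t) :
    ∃ h : EuclideanSpace ℝ (Fin n) → ℝ≥0∞, Measurable h ∧ (∀ x, h x < ⊤) ∧
      (∀ t, 0 < t → rearr volume h t ≤ ψ t) ∧ a < ∫⁻ x, g x * h x := by
  have hψm : AEMeasurable ψ (volume.restrict (Ioi (0 : ℝ))) :=
    aemeasurable_restrict_of_antitoneOn measurableSet_Ioi hψ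
  set G := hg.mk g
  have hG : Measurable G := hg.measurable_mk
  set F : ℕ → SimpleFunc (EuclideanSpace ℝ (Fin n)) ℝ≥0∞ := fun k =>
    (SimpleFunc.eapprox G k).restrict (Metric.ball 0 k)
  have hF : ∀ k x, F k x = (Metric.ball 0 (k : ℝ)).indicator (SimpleFunc.eapprox G k) x :=
    fun k x => by rw [SimpleFunc.restrict_apply _ measurableSet_ball]
  have hFle : ∀ k x, F k x ≤ G x := fun k x => by
    rw [hF]
    refine (indicator_le_self _ _ x).trans ?_
    rw [← SimpleFunc.iSup_eapprox_apply hG x]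
    exact le_iSup (fun k => SimpleFunc.eapprox G k x) k
  have hFmono : ∀ x, Monotone fun k => F k x := by
    intro x i j hij
    simp only [hF]
    refine (indicator_le_indicator (SimpleFunc.monotone_eapprox G hij x)).trans ?_
    exact indicator_le_indicator_of_subset (Metric.ball_subset_ball (by exact_mod_cast hij))
      (fun _ => bot_le) x
  have hFsup : ∀ x, G x = ⨆ k, F k x := by
    intro x
    refine le_antisymm ?_ (iSup_le fun k => hFle k x)
    conv_lhs => rw [← SimpleFunc.iSup_eapprox_apply hG x]
    obtain ⟨m, hm⟩ := exists_nat_gt ‖x‖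
    refine iSup_le fun k => le_iSup_of_le (max k m) ?_
    rw [hF, indicator_of_mem]
    · exact SimpleFunc.monotone_eapprox G (le_max_left k m) x
    · rw [mem_ball_zero_iff]
      exact hm.trans_le (by exact_mod_cast le_max_right k m)
  rw [rearr_congr_ae hg.ae_eq_mk, lintegral_rearr_iSup_mul
    (fun k => ae_of_all _ fun x => hFmono x k.le_succ) (ae_of_all _ hFsup) hψm, lt_iSup_iff] at ha
  obtain ⟨k, hk⟩ := ha
  have hmin : ∫⁻ t in Ioi (0 : ℝ), rearr volume (F k) t * ψ t =
      ⨆ j : ℕ, ∫⁻ t in Ioi (0 : ℝ), rearr volume (F k) t * min (ψ t) j := by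
    rw [← lintegral_iSup' (f := fun (j : ℕ) t => rearr volume (F k) t * min (ψ t) j)]
    · refine lintegral_congr fun t => ?_
      rw [← ENNReal.mul_iSup, ← inf_iSup_eq (f := fun j : ℕ => (j : ℝ≥0∞)),
        ENNReal.iSup_natCast, inf_top_eq]
    · exact fun j => (measurable_rearr _).aemeasurable.mul (hψm.min aemeasurable_const)
    · refine ae_of_all _ fun t i j hij => ?_
      have : (i : ℝ≥0∞) ≤ j := by exact_mod_cast hij
      dsimp only
      gcongr
  rw [hmin, lt_iSup_iff] at hk
  obtain ⟨j, hj⟩ := hk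
  set I := ∫⁻ t in Ioi (0 : ℝ), rearr volume (F k) t * min (ψ t) j
  -- The strict inequality leaves room for the factor `1 + ε` lost for simple functions.
  obtain ⟨ε, hε, hεI⟩ : ∃ ε : ℝ, 0 < ε ∧ ENNReal.ofReal (1 + ε) * a < I := by
    have hc : Tendsto (fun ε : ℝ => ENNReal.ofReal (1 + ε) * a) (𝓝[>] 0)
        (𝓝 (ENNReal.ofReal (1 + 0) * a)) := by
      refine Tendsto.mono_left ?_ nhdsWithin_le_nhds
      refine ENNReal.Tendsto.mul_const ?_ (Or.inr hj.ne_top)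
      exact (ENNReal.continuous_ofReal.comp (continuous_const.add continuous_id)).tendsto 0
    have h2 := (hc.eventually_lt_const (u := I) (by simpa using hj)).and self_mem_nhdsWithin
    obtain ⟨ε, h1, h2⟩ := h2.exists
    exact ⟨ε, h2, h1⟩
  -- The cap `j` keeps `h` finite, and the value `j` on `t ≤ 0` makes the weight antitone on the
  -- whole line.
  set ψ' : ℝ → ℝ≥0∞ := fun t => if 0 < t then min (ψ t) j else j
  have hψ' : Antitone ψ' := by
    intro s t hst
    by_cases hs : 0 < s
    · have ht := hs.trans_le hst
      simp only [ψ', hs, ht, if_true]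
      exact min_le_min_right _ (hψ hs ht hst)
    · simp only [ψ', hs, if_false]
      split_ifs
      · exact min_le_right _ _
      · exact le_rfl
  obtain ⟨h, hm, hr, hle, hI⟩ := exists_rearr_le_lintegral_mul_simpleFunc hn (F k)
    (fun x => by
      rw [hF]
      exact (indicator_le_self _ _ x).trans_lt (SimpleFunc.eapprox_lt_top G k x))
    ((measure_mono fun x hx => by
      by_contra hxb
      have hx' : 0 < F k x := hx
      rw [hF, indicator_of_notMem hxb] at hx'
      exact lt_irrefl _ hx').trans_lt
        (measure_ball_lt_top (x := (0 : EuclideanSpace ℝ (Fin n))) (r := k))) hψ' hε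
  refine ⟨h, hm, fun x => ?_, fun t ht => (hle t ht).trans ?_, ?_⟩
  · rcases hr x with h0 | ⟨t, ht⟩
    · simp [h0]
    · rw [← ht]
      refine lt_of_le_of_lt (b := (j : ℝ≥0∞)) ?_ (ENNReal.natCast_lt_top j)
      simp only [ψ']
      split_ifs
      · exact min_le_right _ _
      · exact le_rfl
  · simp only [ψ', ht, if_true]
    exact min_le_left _ _
  · have hII : I = ∫⁻ t in Ioi (0 : ℝ), rearr volume (F k) t * ψ' t := by
      refine setLIntegral_congr_fun measurableSet_Ioi fun t ht => ?_
      simp only [ψ', mem_Ioi.1 ht, if_true]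
    have h1 : ENNReal.ofReal (1 + ε) * a < ENNReal.ofReal (1 + ε) * ∫⁻ x, F k x * h x :=
      hεI.trans_le (hII.trans_le hI)
    refine (lt_of_mul_lt_mul_left' h1).trans_le ?_
    refine lintegral_mono_ae ?_
    filter_upwards [hg.ae_eq_mk] with x hx
    rw [hx]
    exact mul_le_mul_left (hFle k x) _

end Resonance

/-! ### Truncations, the bridge from general functions to `L²`. -/

section Truncation

variable {n : ℕ}

/-- Truncation to height `k` and to the ball of radius `k`. -/
noncomputable def trunc (k : ℕ) (f : EuclideanSpace ℝ (Fin n) → ℝ≥0∞)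
    (x : EuclideanSpace ℝ (Fin n)) : ℝ≥0∞ :=
  (Metric.ball (0 : EuclideanSpace ℝ (Fin n)) k).indicator (fun x => min (f x) k) x

theorem trunc_le (k : ℕ) (f : EuclideanSpace ℝ (Fin n) → ℝ≥0∞) (x : EuclideanSpace ℝ (Fin n)) :
    trunc k f x ≤ f x :=
  (indicator_le_self _ _ x).trans (min_le_left _ _)

theorem trunc_le_indicator (k : ℕ) (f : EuclideanSpace ℝ (Fin n) → ℝ≥0∞)
    (x : EuclideanSpace ℝ (Fin n)) :
    trunc k f x ≤ (Metric.ball (0 : EuclideanSpace ℝ (Fin n)) k).indicator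
      (fun _ => (k : ℝ≥0∞)) x :=
  indicator_le_indicator (min_le_right _ _)

theorem trunc_lt_top (k : ℕ) (f : EuclideanSpace ℝ (Fin n) → ℝ≥0∞)
    (x : EuclideanSpace ℝ (Fin n)) : trunc k f x < ⊤ :=
  ((trunc_le_indicator k f x).trans (indicator_le_self _ _ x)).trans_lt (ENNReal.natCast_lt_top k)

theorem monotone_trunc (f : EuclideanSpace ℝ (Fin n) → ℝ≥0∞) (x : EuclideanSpace ℝ (Fin n)) :
    Monotone fun k => trunc k f x := by
  intro i j hij
  have h : (i : ℝ≥0∞) ≤ j := by exact_mod_cast hij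
  have h' : min (f x) i ≤ min (f x) j := min_le_min le_rfl h
  refine (indicator_le_indicator (f := fun x => min (f x) i) (g := fun x => min (f x) j)
    h').trans ?_
  exact indicator_le_indicator_of_subset (Metric.ball_subset_ball (by exact_mod_cast hij))
    (fun _ => bot_le) x

theorem iSup_trunc (f : EuclideanSpace ℝ (Fin n) → ℝ≥0∞) (x : EuclideanSpace ℝ (Fin n)) :
    ⨆ k, trunc k f x = f x := by
  refine le_antisymm (iSup_le fun k => trunc_le k f x) ?_
  have h : f x = ⨆ k : ℕ, min (f x) k := by
    rw [← inf_iSup_eq (f := fun j : ℕ => (j : ℝ≥0∞)), ENNReal.iSup_natCast, inf_top_eq]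
  obtain ⟨m, hm⟩ := exists_nat_gt ‖x‖
  rw [h]
  refine iSup_le fun k => le_iSup_of_le (max k m) ?_
  rw [trunc, indicator_of_mem]
  · refine le_min ?_ ?_
    · exact min_le_left _ _
    · refine (min_le_right _ _).trans ?_
      exact_mod_cast le_max_left k m
  · rw [mem_ball_zero_iff]
    exact hm.trans_le (by exact_mod_cast le_max_right k m)

theorem tendsto_trunc (f : EuclideanSpace ℝ (Fin n) → ℝ≥0∞) (x : EuclideanSpace ℝ (Fin n)) :
    Tendsto (fun k => trunc k f x) atTop (𝓝 (f x)) := by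
  rw [← iSup_trunc f x]
  exact tendsto_atTop_iSup (monotone_trunc f x)

theorem aemeasurable_trunc (k : ℕ) {f : EuclideanSpace ℝ (Fin n) → ℝ≥0∞}
    (hf : AEMeasurable f volume) : AEMeasurable (trunc k f) volume :=
  (hf.min aemeasurable_const).indicator measurableSet_ball

theorem memLp_two_of_enorm_le_trunc {k : ℕ} {f : EuclideanSpace ℝ (Fin n) → ℝ≥0∞}
    {φ : EuclideanSpace ℝ (Fin n) → ℝ} (hφ : AEStronglyMeasurable φ volume)
    (h : ∀ x, ‖φ x‖ₑ ≤ trunc k f x) : MemLp φ 2 volume := by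
  have h1 : MemLp ((Metric.ball (0 : EuclideanSpace ℝ (Fin n)) k).indicator
      (fun _ => (k : ℝ))) 2 volume :=
    memLp_indicator_const 2 measurableSet_ball (k : ℝ) (Or.inr measure_ball_lt_top.ne)
  refine MemLp.of_le_enorm h1 hφ (ae_of_all _ fun x => ?_)
  refine (h x).trans ((trunc_le_indicator k f x).trans ?_)
  by_cases hx : x ∈ Metric.ball (0 : EuclideanSpace ℝ (Fin n)) k
  · rw [indicator_of_mem hx, indicator_of_mem hx]
    simp
  · rw [indicator_of_notMem hx]; exact bot_le

theorem enorm_ofReal_toReal {y : ℝ≥0∞} (hy : y < ⊤) : ‖((y.toReal : ℝ) : ℂ)‖ₑ = y := by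
  rw [← ofReal_norm, Complex.norm_real, Real.norm_of_nonneg ENNReal.toReal_nonneg,
    ENNReal.ofReal_toReal hy.ne]

end Truncation

/-! ### Duality for rearrangement-invariant norms. -/

namespace RIS

variable {n : ℕ} (X : RIS n)

theorem ρ_congr {f g : EuclideanSpace ℝ (Fin n) → ℝ≥0∞} (hf : AEMeasurable f volume)
    (h : f =ᵐ[volume] g) : X.ρ f = X.ρ g :=
  le_antisymm (X.mono f g hf (hf.congr h) h.le) (X.mono g f (hf.congr h) hf h.symm.le)

theorem ρ_zero : X.ρ (fun _ => 0) = 0 :=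
  (X.eq_zero_iff _ aemeasurable_const).2 (by rfl)

theorem volume_ball_pos (k : ℕ) :
    0 < volume (Metric.ball (0 : EuclideanSpace ℝ (Fin n)) ((k : ℝ) + 1)) :=
  Metric.measure_ball_pos _ _ (by positivity)

theorem ae_lt_top {f : EuclideanSpace ℝ (Fin n) → ℝ≥0∞} (hf : AEMeasurable f volume)
    (h : X.ρ f < ⊤) : ∀ᵐ x, f x < ⊤ := by
  have h1 : ∀ k : ℕ, ∀ᵐ x, x ∈ Metric.ball (0 : EuclideanSpace ℝ (Fin n)) ((k : ℝ) + 1) →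
      f x < ⊤ := by
    intro k
    rw [← ae_restrict_iff' measurableSet_ball]
    refine ae_lt_top' hf.restrict ?_
    obtain ⟨c, hc⟩ := X.local_integrable _ measurableSet_ball (volume_ball_pos k)
      measure_ball_lt_top
    exact ((hc f hf).trans_lt (ENNReal.mul_lt_top ENNReal.coe_lt_top h)).ne
  filter_upwards [ae_all_iff.2 h1] with x hx
  obtain ⟨k, hk⟩ := exists_nat_gt ‖x‖
  exact hx k (by rw [mem_ball_zero_iff]; linarith)

theorem fatou_iSup {F : ℕ → EuclideanSpace ℝ (Fin n) → ℝ≥0∞}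
    {f : EuclideanSpace ℝ (Fin n) → ℝ≥0∞} (hF : ∀ k, AEMeasurable (F k) volume)
    (hf : AEMeasurable f volume) (hmono : ∀ k, F k ≤ᵐ[volume] F (k + 1))
    (hlim : ∀ᵐ x ∂volume, Tendsto (fun k => F k x) atTop (𝓝 (f x))) :
    X.ρ f = ⨆ k, X.ρ (F k) :=
  tendsto_nhds_unique (X.fatou F f hF hf hmono hlim)
    (tendsto_atTop_iSup (monotone_nat_of_le_succ fun k => X.mono _ _ (hF k) (hF _) (hmono k)))

theorem ρ_tsum_le {F : ℕ → EuclideanSpace ℝ (Fin n) → ℝ≥0∞}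
    (hF : ∀ k, AEMeasurable (F k) volume) :
    X.ρ (fun x => ∑' k, F k x) ≤ ∑' k, X.ρ (F k) := by
  have hS : ∀ k, AEMeasurable (fun x => ∑ i ∈ Finset.range k, F i x) volume := fun k =>
    Finset.aemeasurable_fun_sum _ fun i _ => hF i
  have hle : ∀ k, X.ρ (fun x => ∑ i ∈ Finset.range k, F i x) ≤
      ∑ i ∈ Finset.range k, X.ρ (F i) := by
    intro k
    induction k with
    | zero => simpa using X.ρ_zero.le
    | succ k ih =>
      simp only [Finset.sum_range_succ]
      exact (X.add_le _ _ (hS k) (hF k)).trans (add_le_add_left ih _)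
  rw [X.fatou_iSup hS (AEMeasurable.tsum hF) (fun k => ae_of_all _ fun x => ?_)
    (ae_of_all _ fun x => ENNReal.summable.hasSum.tendsto_sum_nat)]
  · exact iSup_le fun k => (hle k).trans (ENNReal.sum_le_tsum _)
  · exact (le_self_add).trans_eq (Finset.sum_range_succ (fun i => F i x) k).symm

/-- The associate function norm on nonnegative functions. -/
noncomputable def assoc (w : EuclideanSpace ℝ (Fin n) → ℝ≥0∞) : ℝ≥0∞ :=
  ⨆ (h : EuclideanSpace ℝ (Fin n) → ℝ≥0∞) (_ : AEMeasurable h volume) (_ : X.ρ h ≤ 1),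
    ∫⁻ x, h x * w x

theorem lintegral_mul_le_assoc {h w : EuclideanSpace ℝ (Fin n) → ℝ≥0∞}
    (hh : AEMeasurable h volume) (h1 : X.ρ h ≤ 1) : ∫⁻ x, h x * w x ≤ X.assoc w :=
  le_iSup_of_le h (le_iSup_of_le hh (le_iSup_of_le h1 le_rfl))

theorem lintegral_mul_le {h w : EuclideanSpace ℝ (Fin n) → ℝ≥0∞}
    (hh : AEMeasurable h volume) (hfin : X.ρ h ≠ ⊤) :
    ∫⁻ x, h x * w x ≤ X.ρ h * X.assoc w := by
  rcases eq_or_ne (X.ρ h) 0 with h0 | h0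
  · rw [X.eq_zero_iff h hh] at h0
    have : ∫⁻ x, h x * w x = ∫⁻ _ : EuclideanSpace ℝ (Fin n), 0 := by
      refine lintegral_congr_ae ?_
      filter_upwards [h0] with x hx
      simp [hx]
    rw [this, lintegral_zero]; exact bot_le
  · obtain ⟨r, hr⟩ : ∃ r : ℝ≥0, (r : ℝ≥0∞) = X.ρ h := ⟨_, ENNReal.coe_toNNReal hfin⟩
    have hr0 : r ≠ 0 := by rintro rfl; simp at hr; exact h0 hr.symm
    have h1 := X.lintegral_mul_le_assoc (w := w) (hh.const_mul ((r⁻¹ : ℝ≥0) : ℝ≥0∞)) (by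
      rw [X.smul _ _ hh, ← hr, ← ENNReal.coe_mul, inv_mul_cancel₀ hr0, ENNReal.coe_one])
    rw [← hr]
    calc ∫⁻ x, h x * w x = ∫⁻ x, r * (((r⁻¹ : ℝ≥0) : ℝ≥0∞) * h x * w x) := by
          refine lintegral_congr fun x => ?_
          rw [← mul_assoc, ← mul_assoc, ← ENNReal.coe_mul, mul_inv_cancel₀ hr0, ENNReal.coe_one,
            one_mul]
      _ = r * ∫⁻ x, ((r⁻¹ : ℝ≥0) : ℝ≥0∞) * h x * w x :=
          lintegral_const_mul' _ _ ENNReal.coe_ne_top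
      _ ≤ _ := by gcongr

/-- Extended-valued test functions add nothing: finite norm forces finiteness almost everywhere. -/
theorem assocNorm_eq_assoc (g : EuclideanSpace ℝ (Fin n) → ℂ) :
    X.assocNorm g = X.assoc fun x => ‖g x‖ₑ := by
  apply le_antisymm
  · refine iSup_le fun f => iSup_le fun hf => iSup_le fun h1 => ?_
    simp only [enorm_mul]
    exact X.lintegral_mul_le_assoc hf.1.enorm h1
  · refine iSup_le fun h => iSup_le fun hh => iSup_le fun h1 => ?_
    have hae : ∀ᵐ x, ‖((h x).toReal : ℂ)‖ₑ = h x := by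
      filter_upwards [X.ae_lt_top hh (h1.trans_lt ENNReal.one_lt_top)] with x hx
      exact enorm_ofReal_toReal hx
    have hm : AEMeasurable (fun x => ((h x).toReal : ℂ)) volume :=
      Complex.measurable_ofReal.comp_aemeasurable hh.ennreal_toReal
    have hρ : X.norm (fun x => ((h x).toReal : ℂ)) = X.ρ h := X.ρ_congr hm.enorm hae
    refine le_iSup_of_le (fun x => ((h x).toReal : ℂ)) (le_iSup_of_le ⟨hm, ?_⟩
      (le_iSup_of_le (hρ.trans_le h1) ?_))
    · rw [hρ]; exact h1.trans_lt ENNReal.one_lt_top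
    · refine (lintegral_congr_ae ?_).le
      filter_upwards [hae] with x hx
      rw [enorm_mul, hx]

/-- Hölder's inequality for rearrangements. Resonance with `ψ = u*` replaces `u` by some `h` with
`h* ≤ u*`, whose norm is no larger by rearrangement invariance. -/
theorem lintegral_rearr_mul_rearr_le (hn : 1 ≤ n) {w u : EuclideanSpace ℝ (Fin n) → ℝ≥0∞}
    (hw : AEMeasurable w volume) (hu : AEMeasurable u volume) (hfin : X.ρ u ≠ ⊤) :
    ∫⁻ t in Ioi (0 : ℝ), rearr volume w t * rearr volume u t ≤ X.ρ u * X.assoc w := by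
  refine le_of_forall_lt fun a ha => ?_
  obtain ⟨h, hm, -, hle, hlt⟩ :=
    exists_rearr_le_lt_lintegral_mul hn hw ((antitone_rearr u).antitoneOn _) ha
  have hρ : X.ρ h ≤ X.ρ u := X.rearr_mono h u hm.aemeasurable hu hle
  calc a < ∫⁻ x, w x * h x := hlt
    _ = ∫⁻ x, h x * w x := by simp only [mul_comm]
    _ ≤ X.ρ h * X.assoc w :=
      X.lintegral_mul_le hm.aemeasurable (ne_top_of_le_ne_top hfin hρ)
    _ ≤ _ := by gcongr

/-- An inclusion between rearrangement-invariant spaces is bounded. -/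
theorem exists_ρ_le_of_mem_imp {X Y : RIS n}
    (h : ∀ f : EuclideanSpace ℝ (Fin n) → ℂ, X.Mem f → Y.Mem f) :
    ∃ C : ℝ≥0, 0 < C ∧ ∀ f : EuclideanSpace ℝ (Fin n) → ℝ≥0∞, AEMeasurable f volume →
      Y.ρ f ≤ C * X.ρ f := by
  by_contra! hcon
  -- If no constant works, violating `C = 4 ^ k` and rescaling gives `X`-norm `2⁻ᵏ` and `Y`-norm at
  -- least `2ᵏ`; the sum of these functions is in `X` but not in `Y`.
  have hk : ∀ k : ℕ, ∃ F : EuclideanSpace ℝ (Fin n) → ℝ≥0∞, AEMeasurable F volume ∧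
      X.ρ F = ((2⁻¹ : ℝ≥0) : ℝ≥0∞) ^ k ∧ (2 : ℝ≥0∞) ^ k ≤ Y.ρ F := by
    intro k
    obtain ⟨f, hf, hlt⟩ := hcon (4 ^ k) (by positivity)
    have h0 : X.ρ f ≠ 0 := by
      intro h0
      rw [(Y.eq_zero_iff f hf).2 ((X.eq_zero_iff f hf).1 h0)] at hlt
      exact not_lt_bot hlt
    have htop : X.ρ f ≠ ⊤ := by
      intro ht
      rw [ht, ENNReal.mul_top (by simp)] at hlt
      exact not_top_lt hlt
    obtain ⟨r, hr⟩ : ∃ r : ℝ≥0, (r : ℝ≥0∞) = X.ρ f := ⟨_, ENNReal.coe_toNNReal htop⟩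
    have hr0 : r ≠ 0 := by rintro rfl; simp at hr; exact h0 hr.symm
    refine ⟨fun x => ((2⁻¹ ^ k * r⁻¹ : ℝ≥0) : ℝ≥0∞) * f x, hf.const_mul _, ?_, ?_⟩
    · rw [X.smul _ _ hf, ← hr, ← ENNReal.coe_mul, mul_assoc, inv_mul_cancel₀ hr0, mul_one,
        ENNReal.coe_pow]
    · rw [Y.smul _ _ hf]
      calc (2 : ℝ≥0∞) ^ k = ((2⁻¹ ^ k * r⁻¹ : ℝ≥0) : ℝ≥0∞) * (((4 ^ k : ℝ≥0) : ℝ≥0∞) * X.ρ f) := by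
            rw [← hr, ← ENNReal.coe_mul, ← ENNReal.coe_mul]
            have : (2⁻¹ ^ k * r⁻¹ * (4 ^ k * r) : ℝ≥0) = 2 ^ k := by
              have h4 : (4 : ℝ≥0) ^ k = 2 ^ k * 2 ^ k := by
                rw [← mul_pow]; norm_num
              rw [h4, inv_pow]
              field_simp
            rw [this]; simp
        _ ≤ _ := by gcongr
  choose F hF hX hY using hk
  set G : EuclideanSpace ℝ (Fin n) → ℝ≥0∞ := fun x => ∑' k, F k x
  have hG : AEMeasurable G volume := AEMeasurable.tsum hF
  have hGX : X.ρ G < ⊤ := by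
    refine (X.ρ_tsum_le hF).trans_lt ?_
    simp only [hX]
    rw [ENNReal.tsum_geometric, ENNReal.inv_lt_top]
    refine tsub_pos_of_lt ?_
    rw [ENNReal.coe_lt_one_iff]
    exact inv_lt_one_of_one_lt₀ one_lt_two
  have hae : ∀ᵐ x, ‖((G x).toReal : ℂ)‖ₑ = G x := by
    filter_upwards [X.ae_lt_top hG hGX] with x hx
    exact enorm_ofReal_toReal hx
  have hm : AEMeasurable (fun x => ((G x).toReal : ℂ)) volume :=
    Complex.measurable_ofReal.comp_aemeasurable hG.ennreal_toReal
  have hYG : Y.ρ G < ⊤ := by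
    have := (h _ ⟨hm, (X.ρ_congr hm.enorm hae).trans_lt hGX⟩).2
    rwa [RIS.norm, Y.ρ_congr hm.enorm hae] at this
  have hall : ∀ k : ℕ, (2 : ℝ≥0∞) ^ k ≤ Y.ρ G := fun k =>
    (hY k).trans (Y.mono _ _ (hF k) hG (ae_of_all _ fun x => ENNReal.le_tsum k))
  have hlim : Tendsto (fun k : ℕ => (2 : ℝ≥0∞) ^ k) atTop (𝓝 ⊤) :=
    ENNReal.tendsto_pow_atTop_nhds_top_iff.2 ENNReal.one_lt_two
  exact hYG.ne (top_le_iff.1 (le_of_tendsto' hlim hall))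

/-- Fatou's lemma for nonmonotone sequences: the tail infima increase to the limit. -/
theorem ρ_le_of_ae_tendsto {F : ℕ → EuclideanSpace ℝ (Fin n) → ℝ≥0∞}
    {f : EuclideanSpace ℝ (Fin n) → ℝ≥0∞} (hF : ∀ k, AEMeasurable (F k) volume)
    (hf : AEMeasurable f volume) (hlim : ∀ᵐ x ∂volume, Tendsto (fun k => F k x) atTop (𝓝 (f x)))
    {c : ℝ≥0∞} (hc : ∀ k, X.ρ (F k) ≤ c) : X.ρ f ≤ c := by
  set G : ℕ → EuclideanSpace ℝ (Fin n) → ℝ≥0∞ := fun k x => ⨅ i, F (k + i) x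
  have hG : ∀ k, AEMeasurable (G k) volume := fun k => AEMeasurable.iInf fun i => hF (k + i)
  have hGF : ∀ k x, G k x ≤ F k x := fun k x => iInf_le (fun i => F (k + i) x) 0
  have hmono : ∀ x, Monotone fun k => G k x := fun x => monotone_nat_of_le_succ fun k =>
    le_iInf fun i => (iInf_le (fun i => F (k + i) x) (i + 1)).trans_eq (by
      rw [add_assoc, add_comm 1 i])
  rw [X.fatou_iSup hG hf (fun k => ae_of_all _ fun x => hmono x k.le_succ)]
  · exact iSup_le fun k => (X.mono _ _ (hG k) (hF k) (ae_of_all _ (hGF k))).trans (hc k)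
  · filter_upwards [hlim] with x hx
    have h1 : f x = ⨆ k, G k x := by
      rw [← hx.liminf_eq, liminf_eq_iSup_iInf_of_nat']
      simp only [G, add_comm]
    rw [h1]
    exact tendsto_atTop_iSup (hmono x)

theorem aemeasurable_enorm_Lp (φ : Lp ℝ 2 (volume : Measure (EuclideanSpace ℝ (Fin n)))) :
    AEMeasurable (fun x => ‖φ x‖ₑ) volume :=
  (Lp.aestronglyMeasurable φ).enorm

theorem inner_Lp_eq_integral_mul (d φ : Lp ℝ 2 (volume : Measure (EuclideanSpace ℝ (Fin n)))) :
    inner ℝ d φ = ∫ x, d x * φ x := by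
  rw [L2.inner_def]
  refine integral_congr_ae (ae_of_all _ fun x => ?_)
  simp only [RCLike.inner_apply, conj_trivial]
  exact mul_comm _ _

theorem integrable_mul_Lp (d φ : Lp ℝ 2 (volume : Measure (EuclideanSpace ℝ (Fin n)))) :
    Integrable (fun x => d x * φ x) volume := by
  refine (L2.integrable_inner (𝕜 := ℝ) d φ).congr (ae_of_all _ fun x => ?_)
  simp only [RCLike.inner_apply, conj_trivial]
  exact mul_comm _ _

/-- The part of the unit ball of `X` that lies in `L²`. -/
def unitBallL2 : Set (Lp ℝ 2 (volume : Measure (EuclideanSpace ℝ (Fin n)))) :=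
  {φ | X.ρ (fun x => ‖φ x‖ₑ) ≤ 1}

theorem zero_mem_unitBallL2 :
    (0 : Lp ℝ 2 (volume : Measure (EuclideanSpace ℝ (Fin n)))) ∈ X.unitBallL2 := by
  change X.ρ _ ≤ 1
  rw [(X.eq_zero_iff _ (aemeasurable_enorm_Lp 0)).2]
  · exact bot_le
  · filter_upwards [Lp.coeFn_zero ℝ 2 (volume : Measure (EuclideanSpace ℝ (Fin n)))] with x hx
    rw [hx]; simp

theorem convex_unitBallL2 : Convex ℝ X.unitBallL2 := by
  intro φ hφ ψ hψ a b ha hb hab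
  have hle : (fun x => ‖(a • φ + b • ψ : Lp ℝ 2 volume) x‖ₑ) ≤ᵐ[volume]
      fun x => (a.toNNReal : ℝ≥0∞) * ‖φ x‖ₑ + (b.toNNReal : ℝ≥0∞) * ‖ψ x‖ₑ := by
    filter_upwards [Lp.coeFn_add (a • φ) (b • ψ), Lp.coeFn_smul a φ, Lp.coeFn_smul b ψ]
      with x h1 h2 h3
    rw [h1, Pi.add_apply, h2, h3]
    refine (enorm_add_le _ _).trans_eq ?_
    simp [enorm_mul, Real.enorm_eq_ofReal ha, Real.enorm_eq_ofReal hb, ENNReal.ofReal]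
  calc X.ρ (fun x => ‖(a • φ + b • ψ : Lp ℝ 2 volume) x‖ₑ)
      ≤ X.ρ (fun x => (a.toNNReal : ℝ≥0∞) * ‖φ x‖ₑ + (b.toNNReal : ℝ≥0∞) * ‖ψ x‖ₑ) :=
        X.mono _ _ (aemeasurable_enorm_Lp _)
          (((aemeasurable_enorm_Lp φ).const_mul _).add
            ((aemeasurable_enorm_Lp ψ).const_mul _)) hle
    _ ≤ a.toNNReal * X.ρ (fun x => ‖φ x‖ₑ) + b.toNNReal * X.ρ (fun x => ‖ψ x‖ₑ) := by
        rw [← X.smul _ _ (aemeasurable_enorm_Lp φ), ← X.smul _ _ (aemeasurable_enorm_Lp ψ)]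
        exact X.add_le _ _ ((aemeasurable_enorm_Lp φ).const_mul _)
          ((aemeasurable_enorm_Lp ψ).const_mul _)
    _ ≤ a.toNNReal * 1 + b.toNNReal * 1 := by gcongr <;> assumption
    _ = 1 := by
        rw [mul_one, mul_one, ← ENNReal.coe_add, ← Real.toNNReal_add ha hb, hab]
        simp

/-- An `L²`-convergent sequence has an almost everywhere convergent subsequence, to which the Fatou
property applies. -/
theorem isClosed_unitBallL2 : IsClosed X.unitBallL2 := by
  refine IsSeqClosed.isClosed fun φ ψ hφ hlim => ?_
  have h2 : TendstoInMeasure volume (fun i => (φ i : EuclideanSpace ℝ (Fin n) → ℝ)) atTop ψ :=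
    tendstoInMeasure_of_tendsto_Lp hlim
  obtain ⟨ns, -, hns⟩ := h2.exists_seq_tendsto_ae
  refine X.ρ_le_of_ae_tendsto (F := fun i x => ‖φ (ns i) x‖ₑ)
    (fun i => aemeasurable_enorm_Lp _) (aemeasurable_enorm_Lp ψ) ?_
    fun i => hφ (ns i)
  filter_upwards [hns] with x hx
  exact hx.enorm

/-- The unit ball is solid: for `h` in the unit ball of `X`, the function `sgn(d) · trunc j h` lies
in `unitBallL2` and pairs with `d` to `∫ |d| trunc j h`. Then let `j → ∞`. -/
theorem assoc_le_of_forall_inner_le {d : Lp ℝ 2 (volume : Measure (EuclideanSpace ℝ (Fin n)))}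
    {a : ℝ} (ha : ∀ φ ∈ X.unitBallL2, inner ℝ d φ ≤ a) :
    X.assoc (fun x => ‖d x‖ₑ) ≤ ENNReal.ofReal a := by
  set w : EuclideanSpace ℝ (Fin n) → ℝ≥0∞ := fun x => ‖d x‖ₑ
  have hw : AEMeasurable w volume := aemeasurable_enorm_Lp d
  set sgn : ℝ → ℝ := fun y => if 0 ≤ y then 1 else -1
  have hsgn : Measurable sgn :=
    Measurable.ite measurableSet_Ici measurable_const measurable_const
  have hsgn1 : ∀ y, ‖sgn y‖ₑ = 1 := fun y => by
    simp only [sgn]; split_ifs <;> simp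
  have hsgn2 : ∀ y, y * sgn y = |y| := fun y => by
    simp only [sgn]
    split_ifs with h
    · rw [mul_one, abs_of_nonneg h]
    · rw [mul_neg_one, abs_of_neg (not_le.1 h)]
  refine iSup_le fun h => iSup_le fun hh => iSup_le fun hh1 => ?_
  have hj : ∀ j, ∫⁻ x, trunc j h x * w x ≤ ENNReal.ofReal a := by
    intro j
    set φ : EuclideanSpace ℝ (Fin n) → ℝ := fun x => sgn (d x) * (trunc j h x).toReal
    have hem : ∀ x, ‖φ x‖ₑ ≤ trunc j h x := fun x => by
      rw [enorm_mul, hsgn1, one_mul, Real.enorm_eq_ofReal ENNReal.toReal_nonneg,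
        ENNReal.ofReal_toReal (trunc_lt_top j h x).ne]
    have hsm : AEStronglyMeasurable φ volume :=
      ((hsgn.comp_aemeasurable (Lp.aestronglyMeasurable d).aemeasurable).mul
        (aemeasurable_trunc j hh).ennreal_toReal).aestronglyMeasurable
    have hL := memLp_two_of_enorm_le_trunc hsm hem
    have hφK : hL.toLp φ ∈ X.unitBallL2 := by
      refine le_trans (X.mono _ h (aemeasurable_enorm_Lp _) hh ?_) hh1
      filter_upwards [hL.coeFn_toLp] with x hx
      rw [hx]
      exact (hem x).trans (trunc_le j h x)
    have hval : ∀ᵐ x, d x * hL.toLp φ x = |d x| * (trunc j h x).toReal := by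
      filter_upwards [hL.coeFn_toLp] with x hx
      rw [hx, ← mul_assoc, hsgn2]
    have hint := integrable_mul_Lp d (hL.toLp φ)
    have h3 := (inner_Lp_eq_integral_mul d (hL.toLp φ)).symm.trans_le (ha _ hφK)
    calc ∫⁻ x, trunc j h x * w x = ∫⁻ x, ENNReal.ofReal (d x * hL.toLp φ x) := by
          refine lintegral_congr_ae ?_
          filter_upwards [hval] with x hx
          rw [hx, ENNReal.ofReal_mul (abs_nonneg _),
            ENNReal.ofReal_toReal (trunc_lt_top j h x).ne, mul_comm]
          congr 1
          exact Real.enorm_eq_ofReal_abs _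
      _ = ENNReal.ofReal (∫ x, d x * hL.toLp φ x) := by
          rw [ofReal_integral_eq_lintegral_ofReal hint]
          filter_upwards [hval] with x hx
          rw [hx]; positivity
      _ ≤ _ := ENNReal.ofReal_le_ofReal h3
  have hsup : ∫⁻ x, h x * w x = ⨆ j, ∫⁻ x, trunc j h x * w x := by
    rw [← lintegral_iSup' (f := fun j x => trunc j h x * w x)
      (fun j => (aemeasurable_trunc j hh).mul hw)
      (ae_of_all _ fun x i j hij => mul_le_mul_left (monotone_trunc h x hij) _)]
    refine lintegral_congr fun x => ?_
    rw [← ENNReal.iSup_mul, iSup_trunc]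
  rw [hsup]
  exact iSup_le hj

/-- Separation of a point from a closed convex set, carried out in the Hilbert space `L²`. A
truncation `u` of `f` still lies outside the unit ball; with `P` its nearest point in the ball, the
normal `d = u - P` separates, and `|d|` suitably scaled is the required function. -/
theorem exists_assoc_le_one_lt_lintegral {f : EuclideanSpace ℝ (Fin n) → ℝ≥0∞}
    (hf : AEMeasurable f volume) (h1 : 1 < X.ρ f) :
    ∃ w : EuclideanSpace ℝ (Fin n) → ℝ≥0∞, AEMeasurable w volume ∧ X.assoc w ≤ 1 ∧
      1 < ∫⁻ x, f x * w x := by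
  obtain ⟨k, hk⟩ : ∃ k, 1 < X.ρ (trunc k f) := by
    rw [X.fatou_iSup (fun k => aemeasurable_trunc k hf) hf
      (fun k => ae_of_all _ fun x => monotone_trunc f x k.le_succ)
      (ae_of_all _ (tendsto_trunc f))] at h1
    exact lt_iSup_iff.1 h1
  have hm0 : AEStronglyMeasurable (fun x => (trunc k f x).toReal) volume :=
    (aemeasurable_trunc k hf).ennreal_toReal.aestronglyMeasurable
  have he0 : ∀ x, ‖(trunc k f x).toReal‖ₑ = trunc k f x := fun x => by
    rw [Real.enorm_eq_ofReal ENNReal.toReal_nonneg, ENNReal.ofReal_toReal (trunc_lt_top k f x).ne]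
  have hL0 := memLp_two_of_enorm_le_trunc hm0 (fun x => (he0 x).le)
  set u := hL0.toLp
  have hu : ∀ᵐ x, ‖u x‖ₑ = trunc k f x := by
    filter_upwards [hL0.coeFn_toLp] with x hx
    rw [hx, he0]
  have huK : u ∉ X.unitBallL2 := by
    intro h
    have h' : X.ρ (fun x => ‖u x‖ₑ) ≤ 1 := h
    rw [X.ρ_congr (aemeasurable_enorm_Lp u) hu] at h'
    exact not_lt.2 h' hk
  obtain ⟨P, hP, hPmin⟩ := exists_norm_eq_iInf_of_complete_convex
    ⟨0, X.zero_mem_unitBallL2⟩ X.isClosed_unitBallL2.isComplete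
    X.convex_unitBallL2 u
  have hvar := (norm_eq_iInf_iff_real_inner_le_zero X.convex_unitBallL2 hP).1 hPmin
  set d := u - P
  have hd : 0 < inner ℝ d d := by
    refine real_inner_self_pos.2 fun h => huK ?_
    rwa [sub_eq_zero.1 h]
  have hdK : ∀ φ ∈ X.unitBallL2, inner ℝ d φ ≤ inner ℝ d P := fun φ hφ => by
    have := hvar φ hφ
    rw [inner_sub_right] at this
    linarith
  have hdP : 0 ≤ inner ℝ d P := by simpa using hdK 0 X.zero_mem_unitBallL2
  have hdu : inner ℝ d P < inner ℝ d u := by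
    have : inner ℝ d d = inner ℝ d u - inner ℝ d P := inner_sub_right _ _ _
    linarith
  -- A level strictly above `⟨d, P⟩`, which may be `0`, so that dividing by `b` is legitimate.
  obtain ⟨b, hb1, hb2⟩ := exists_between hdu
  have hb : 0 < b := hdP.trans_lt hb1
  set w : EuclideanSpace ℝ (Fin n) → ℝ≥0∞ := fun x => ‖d x‖ₑ
  have hassoc : X.assoc w ≤ ENNReal.ofReal b :=
    X.assoc_le_of_forall_inner_le fun φ hφ => (hdK φ hφ).trans hb1.le
  have hlow : ENNReal.ofReal b < ∫⁻ x, f x * w x := by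
    calc ENNReal.ofReal b < ENNReal.ofReal (inner ℝ d u) :=
          (ENNReal.ofReal_lt_ofReal_iff (hb.trans hb2)).2 hb2
      _ ≤ ‖∫ x, d x * u x‖ₑ := by rw [inner_Lp_eq_integral_mul]; exact Real.ofReal_le_enorm _
      _ ≤ ∫⁻ x, ‖d x * u x‖ₑ := enorm_integral_le_lintegral_enorm _
      _ ≤ ∫⁻ x, f x * w x := by
          refine lintegral_mono_ae ?_
          filter_upwards [hu] with x hx
          rw [enorm_mul, hx, mul_comm]
          exact mul_le_mul_left (trunc_le k f x) _
  set B := ENNReal.ofReal b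
  have hB0 : B ≠ 0 := by simpa [B] using hb
  have hBt : B ≠ ⊤ := ENNReal.ofReal_ne_top
  refine ⟨fun x => B⁻¹ * w x, (aemeasurable_enorm_Lp d).const_mul _, ?_, ?_⟩
  · refine iSup_le fun h => iSup_le fun hh => iSup_le fun hh1 => ?_
    have := X.lintegral_mul_le_assoc (w := w) hh hh1
    calc ∫⁻ x, h x * (B⁻¹ * w x) = B⁻¹ * ∫⁻ x, h x * w x := by
          rw [← lintegral_const_mul' _ _ (ENNReal.inv_ne_top.2 hB0)]
          simp only [mul_left_comm]
      _ ≤ B⁻¹ * B := by gcongr; exact this.trans hassoc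
      _ = 1 := ENNReal.inv_mul_cancel hB0 hBt
  · calc 1 = B⁻¹ * B := (ENNReal.inv_mul_cancel hB0 hBt).symm
      _ < B⁻¹ * ∫⁻ x, f x * w x :=
        ENNReal.mul_lt_mul_right (ENNReal.inv_ne_zero.2 hBt) (ENNReal.inv_ne_top.2 hB0) hlow
      _ = _ := by
          rw [← lintegral_const_mul' _ _ (ENNReal.inv_ne_top.2 hB0)]
          simp only [mul_left_comm]

/-- The Lorentz–Luxemburg theorem: a function norm is dominated by its second associate norm. -/
theorem ρ_le_iSup_assoc {f : EuclideanSpace ℝ (Fin n) → ℝ≥0∞} (hf : AEMeasurable f volume) :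
    X.ρ f ≤ ⨆ (w : EuclideanSpace ℝ (Fin n) → ℝ≥0∞) (_ : AEMeasurable w volume)
      (_ : X.assoc w ≤ 1), ∫⁻ x, f x * w x := by
  refine le_of_not_gt fun hlt => ?_
  obtain ⟨c, hc1, hc2⟩ := ENNReal.lt_iff_exists_nnreal_btwn.1 hlt
  have hc0 : c ≠ 0 := by rintro rfl; exact not_lt_bot hc1
  have hc0' : (c : ℝ≥0∞) ≠ 0 := by simpa using hc0
  obtain ⟨w, hw, hw1, hlt'⟩ := X.exists_assoc_le_one_lt_lintegral
    (hf.const_mul ((c⁻¹ : ℝ≥0) : ℝ≥0∞)) (by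
      rw [X.smul _ _ hf, ENNReal.coe_inv hc0]
      calc (1 : ℝ≥0∞) = (c : ℝ≥0∞)⁻¹ * c :=
            (ENNReal.inv_mul_cancel hc0' ENNReal.coe_ne_top).symm
        _ < _ := ENNReal.mul_lt_mul_right (by simp) (by simpa using hc0) hc2)
  refine hc1.not_ge ?_
  refine le_iSup_of_le w (le_iSup_of_le hw (le_iSup_of_le hw1 ?_))
  simp only [mul_assoc] at hlt'
  rw [lintegral_const_mul' _ _ ENNReal.coe_ne_top, ENNReal.coe_inv hc0] at hlt'
  calc (c : ℝ≥0∞) = c * 1 := (mul_one _).symm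
    _ ≤ c * ((c : ℝ≥0∞)⁻¹ * ∫⁻ x, f x * w x) := by gcongr
    _ = _ := by rw [← mul_assoc, ENNReal.mul_inv_cancel hc0' ENNReal.coe_ne_top, one_mul]

end RIS

/-! ### Growth of functions in `B_n(∞)`. -/

section ClassBEstimates

variable {n : ℕ} {Φ : ℝ → ℝ}

/-- `Φ(r) rⁿ` is quasi-increasing. -/
theorem ClassB.exists_mul_pow_le (hΦ : ClassB n Φ) (hn : 1 ≤ n) :
    ∃ A : ℝ≥0, 0 < A ∧ ∀ r R : ℝ, 0 < r → r ≤ R →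
      ENNReal.ofReal (Φ r) * ENNReal.ofReal (r ^ n) ≤
        A * (ENNReal.ofReal (Φ R) * ENNReal.ofReal (R ^ n)) := by
  obtain ⟨C, hC, hint⟩ := hΦ.integral_le
  refine ⟨(2 ^ n * C).toNNReal, by positivity, fun r R hr hrR => ?_⟩
  have hR := hr.trans_le hrR
  have hΦr := hΦ.pos r hr
  have hΦR := hΦ.pos R hR
  have h1 : ENNReal.ofReal (Φ r * (r / 2) ^ n) ≤ ENNReal.ofReal (C * Φ R * R ^ n) := by
    refine le_trans ?_ (hint R hR)
    -- Keep only `(r/2, r)` of the integral up to `R`; there `Φ s ≥ Φ r` and `s ≥ r/2`.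
    calc ENNReal.ofReal (Φ r * (r / 2) ^ n)
        = ∫⁻ _ in Ioo (r / 2) r, ENNReal.ofReal (Φ r * (r / 2) ^ (n - 1)) := by
          rw [setLIntegral_const, Real.volume_Ioo, ← ENNReal.ofReal_mul (by positivity)]
          congr 1
          obtain ⟨m, rfl⟩ := Nat.exists_eq_add_of_le' hn
          simp only [Nat.add_sub_cancel, pow_succ]
          ring
      _ ≤ ∫⁻ s in Ioo (r / 2) r, ENNReal.ofReal (Φ s * s ^ (n - 1)) := by
          refine setLIntegral_mono' measurableSet_Ioo fun s hs => ?_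
          have hs0 : 0 < s := (by positivity : (0 : ℝ) < r / 2).trans hs.1
          have := hΦ.anti hs0 hr hs.2.le
          refine ENNReal.ofReal_le_ofReal ?_
          have h0 := (hΦ.pos s hs0).le
          gcongr
          exact hs.1.le
      _ ≤ _ := by
          refine lintegral_mono_set fun s hs => ⟨?_, hs.2.trans_le hrR⟩
          exact (by positivity : (0 : ℝ) < r / 2).trans hs.1
  rw [ENNReal.ofReal_le_ofReal_iff (by positivity)] at h1
  rw [← ENNReal.ofReal_mul hΦr.le, ← ENNReal.ofReal_mul hΦR.le]
  change _ ≤ ENNReal.ofReal _ * _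
  rw [← ENNReal.ofReal_mul (by positivity)]
  refine ENNReal.ofReal_le_ofReal ?_
  calc Φ r * r ^ n = 2 ^ n * (Φ r * (r / 2) ^ n) := by
        rw [div_pow]; field_simp
    _ ≤ 2 ^ n * (C * Φ R * R ^ n) := by gcongr
    _ = _ := by ring

/-- Doubling property of the class `B_n(∞)`. -/
theorem ClassB.exists_comparison (hΦ : ClassB n Φ) (hn : 1 ≤ n) {a b : ℝ} (ha : 0 < a)
    (hb : 0 < b) : ∃ C : ℝ≥0, 0 < C ∧ ∀ R : ℝ, 0 < R →
      ENNReal.ofReal (Φ (a * R)) ≤ C * ENNReal.ofReal (Φ (b * R)) := by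
  obtain ⟨A, hA, h⟩ := hΦ.exists_mul_pow_le hn
  -- Monotonicity passes from `a R` down to `m R`; quasi-monotonicity of `Φ(r) rⁿ` passes back up to
  -- `b R`.
  set m := min a b
  have hm : 0 < m := lt_min ha hb
  refine ⟨A * (b ^ n / m ^ n).toNNReal, by positivity, fun R hR => ?_⟩
  have h1 := h (m * R) (b * R) (by positivity) (by gcongr; exact min_le_right _ _)
  have h2 : ENNReal.ofReal (Φ (a * R)) ≤ ENNReal.ofReal (Φ (m * R)) :=
    ENNReal.ofReal_le_ofReal (hΦ.anti (by simp; positivity) (by simp; positivity)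
      (by gcongr; exact min_le_left _ _))
  refine h2.trans ?_
  have hne : ENNReal.ofReal ((m * R) ^ n) ≠ 0 := by simp; positivity
  rw [← ENNReal.mul_le_mul_iff_left hne ENNReal.ofReal_ne_top]
  refine h1.trans_eq ?_
  have h3 : ENNReal.ofReal ((b * R) ^ n) =
      ((b ^ n / m ^ n).toNNReal : ℝ≥0∞) * ENNReal.ofReal ((m * R) ^ n) := by
    change _ = ENNReal.ofReal _ * _
    rw [← ENNReal.ofReal_mul (by positivity)]
    congr 1
    rw [mul_pow, mul_pow]; field_simp
  rw [h3, ENNReal.coe_mul]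
  ring

end ClassBEstimates

/-! ### The supremal operator. -/

section SupremalOperator

variable {n : ℕ} {Φ : ℝ → ℝ}

theorem rpow_inv_pow (hn : 1 ≤ n) {t : ℝ} (ht : 0 ≤ t) : (t ^ (1 / (n : ℝ))) ^ n = t := by
  rw [one_div]
  exact Real.rpow_inv_natCast_pow ht (by omega)

theorem pow_rpow_inv (hn : 1 ≤ n) {t : ℝ} (ht : 0 ≤ t) : (t ^ n) ^ (1 / (n : ℝ)) = t := by
  rw [one_div]
  exact Real.pow_rpow_inv_natCast ht (by omega)

theorem antitone_supOp (Φ : ℝ → ℝ) (f : EuclideanSpace ℝ (Fin n) → ℂ) : Antitone (supOp Φ f) :=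
  fun _ _ h => iSup_mono fun _ => iSup_mono' fun h' => ⟨h.trans_lt h', le_rfl⟩

theorem ofReal_mul_rearrAvg (hΦ : ClassB n Φ) (w : EuclideanSpace ℝ (Fin n) → ℝ≥0∞) {t : ℝ}
    (ht : 0 < t) :
    ENNReal.ofReal (Φ (t ^ (1 / (n : ℝ))) * t) * rearrAvg volume w t =
      ENNReal.ofReal (Φ (t ^ (1 / (n : ℝ)))) * ∫⁻ τ in Ioo 0 t, rearr volume w τ := by
  have h0 : ENNReal.ofReal t ≠ 0 := by simpa using ht
  rw [rearrAvg, ENNReal.ofReal_mul (hΦ.pos _ (by positivity)).le, mul_assoc,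
    ENNReal.mul_div_cancel h0 ENNReal.ofReal_ne_top]

theorem le_supOp (hΦ : ClassB n Φ) (f : EuclideanSpace ℝ (Fin n) → ℂ) {τ t : ℝ} (hτ : 0 ≤ τ)
    (ht : τ < t) :
    ENNReal.ofReal (Φ (t ^ (1 / (n : ℝ)))) * ∫⁻ s in Ioo 0 t, rearr volume (fun x => ‖f x‖ₑ) s ≤
      supOp Φ f τ := by
  rw [← ofReal_mul_rearrAvg hΦ _ (hτ.trans_lt ht)]
  exact le_iSup_of_le t (le_iSup_of_le ht le_rfl)

theorem supOp_le_iff (hΦ : ClassB n Φ) (f : EuclideanSpace ℝ (Fin n) → ℂ) {τ : ℝ} (hτ : 0 ≤ τ)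
    {y : ℝ≥0∞} :
    supOp Φ f τ ≤ y ↔ ∀ t, τ < t → ENNReal.ofReal (Φ (t ^ (1 / (n : ℝ)))) *
      ∫⁻ s in Ioo 0 t, rearr volume (fun x => ‖f x‖ₑ) s ≤ y := by
  refine ⟨fun h t ht => (le_supOp hΦ f hτ ht).trans h, fun h => ?_⟩
  refine iSup_le fun t => iSup_le fun ht => ?_
  rw [ofReal_mul_rearrAvg hΦ _ (hτ.trans_lt ht)]
  exact h t ht

end SupremalOperator

/-! ### Two-sided rearrangement estimates for the maximal function. -/

section Maximal

variable {n : ℕ} {Φ : ℝ → ℝ}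

/-- The maximal function is lower semicontinuous. -/
theorem measurable_maximalFn (Φ : ℝ → ℝ) (f : EuclideanSpace ℝ (Fin n) → ℂ) :
    Measurable (maximalFn Φ f) := by
  refine measurable_of_Ioi fun a => IsOpen.measurableSet ?_
  rw [Metric.isOpen_iff]
  intro x hx
  obtain ⟨r, hr⟩ := lt_iSup_iff.1 (show a < maximalFn Φ f x from hx)
  obtain ⟨hr0, hr⟩ := lt_iSup_iff.1 hr
  -- A slightly smaller concentric ball already exceeds the level `a`, and it is contained in the
  -- `r`-ball about every nearby centre.
  have hU : Metric.ball x r = ⋃ k : ℕ, Metric.ball x (r - 1 / ((k : ℝ) + 1)) := by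
    ext z
    simp only [Metric.mem_ball, mem_iUnion]
    constructor
    · intro h
      obtain ⟨k, hk⟩ := exists_nat_one_div_lt (sub_pos.2 h)
      exact ⟨k, by linarith⟩
    · rintro ⟨k, hk⟩
      have : 0 < 1 / ((k : ℝ) + 1) := by positivity
      linarith
  have hmono : Monotone fun k : ℕ => Metric.ball x (r - 1 / ((k : ℝ) + 1)) := by
    intro i j hij
    refine Metric.ball_subset_ball ?_
    have : 1 / ((j : ℝ) + 1) ≤ 1 / ((i : ℝ) + 1) := by
      gcongr
    linarith
  rw [hU, setLIntegral_iUnion_of_directed _ hmono.directed_le, ENNReal.mul_iSup,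
    lt_iSup_iff] at hr
  obtain ⟨k, hk⟩ := hr
  refine ⟨1 / ((k : ℝ) + 1), by positivity, fun z hz => ?_⟩
  refine hk.trans_le (le_iSup_of_le r (le_iSup_of_le hr0 ?_))
  gcongr
  refine Metric.ball_subset_ball' ?_
  rw [dist_comm]
  linarith [Metric.mem_ball.1 hz]

theorem volume_ball_eq (hn : 1 ≤ n) (x : EuclideanSpace ℝ (Fin n)) {r : ℝ} (hr : 0 ≤ r) :
    volume (Metric.ball x r) =
      ENNReal.ofReal (r ^ n) * volume (Metric.ball (0 : EuclideanSpace ℝ (Fin n)) 1) := by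
  have : Nonempty (Fin n) := ⟨⟨0, hn⟩⟩
  rw [Measure.addHaar_ball _ _ hr, finrank_euclideanSpace_fin]

theorem unitBall_toReal_pos :
    0 < (volume (Metric.ball (0 : EuclideanSpace ℝ (Fin n)) 1)).toReal :=
  ENNReal.toReal_pos (Metric.measure_ball_pos _ _ one_pos).ne' measure_ball_lt_top.ne

theorem volume_ball_eq_ofReal (hn : 1 ≤ n) (x : EuclideanSpace ℝ (Fin n)) {r : ℝ} (hr : 0 ≤ r) :
    volume (Metric.ball x r) = ENNReal.ofReal
      ((volume (Metric.ball (0 : EuclideanSpace ℝ (Fin n)) 1)).toReal * r ^ n) := by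
  rw [volume_ball_eq hn x hr, ENNReal.ofReal_mul ENNReal.toReal_nonneg,
    ENNReal.ofReal_toReal measure_ball_lt_top.ne, mul_comm]

theorem setLIntegral_ball_le_rearr (hn : 1 ≤ n) {F : EuclideanSpace ℝ (Fin n) → ℝ≥0∞}
    (hF : AEMeasurable F volume) (x : EuclideanSpace ℝ (Fin n)) {r : ℝ} (hr : 0 ≤ r) :
    ∫⁻ y in Metric.ball x r, F y ≤ ∫⁻ s in
      Ioo 0 ((volume (Metric.ball (0 : EuclideanSpace ℝ (Fin n)) 1)).toReal * r ^ n),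
        rearr volume F s := by
  rw [← initSeg_ofReal, ← volume_ball_eq_ofReal hn x hr]
  exact setLIntegral_le_rearr hF _

/-- The Vitali covering step. -/
theorem measure_le_of_forall_exists_ball (hn : 1 ≤ n) {F : EuclideanSpace ℝ (Fin n) → ℝ≥0∞}
    {S : Set (EuclideanSpace ℝ (Fin n))} {ρ : ℝ} {c J : ℝ≥0∞}
    (hJ : ∫⁻ x, F x ≤ J)
    (h : ∀ x ∈ S, ∃ r, 0 < r ∧ r ≤ ρ ∧
      c * ENNReal.ofReal (r ^ n) ≤ ∫⁻ y in Metric.ball x r, F y) :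
    c * volume S ≤
      ENNReal.ofReal (4 ^ n) * volume (Metric.ball (0 : EuclideanSpace ℝ (Fin n)) 1) * J := by
  have : Nonempty (Fin n) := ⟨⟨0, hn⟩⟩
  choose! r hr0 hrρ hr using h
  -- The enlargement factor `4` is any number above the critical `3`; it produces the `4 ^ n` in the
  -- bound.
  obtain ⟨u, huS, hdisj, hcov⟩ :=
    Vitali.exists_disjoint_subfamily_covering_enlargement_closedBall S id r ρ hrρ 4 (by norm_num)
  have hdisj' : u.PairwiseDisjoint fun a => Metric.ball a (r a) :=
    hdisj.mono fun a => Metric.ball_subset_closedBall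
  have hcount : u.Countable := by
    refine hdisj'.countable_of_isOpen (fun a _ => Metric.isOpen_ball) fun a ha => ?_
    exact Metric.nonempty_ball.2 (hr0 a (huS ha))
  have hsub : S ⊆ ⋃ a ∈ u, Metric.closedBall a (4 * r a) := by
    intro x hx
    obtain ⟨b, hb, hxb⟩ := hcov x hx
    exact mem_iUnion₂.2 ⟨b, hb, hxb (Metric.mem_closedBall_self (hr0 x hx).le)⟩
  have := hcount.to_subtype
  set W := volume (Metric.ball (0 : EuclideanSpace ℝ (Fin n)) 1)
  have hvol : ∀ a : u, volume (Metric.closedBall (a : EuclideanSpace ℝ (Fin n)) (4 * r a)) =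
      ENNReal.ofReal (4 ^ n) * W * ENNReal.ofReal (r a ^ n) := fun a => by
    have h0 := (hr0 a (huS a.2)).le
    rw [Measure.addHaar_closedBall _ _ (by positivity), finrank_euclideanSpace_fin, mul_pow,
      ENNReal.ofReal_mul (by positivity)]
    ring
  calc c * volume S ≤ c * ∑' a : u, volume (Metric.closedBall (a : EuclideanSpace ℝ (Fin n))
        (4 * r a)) := by
        gcongr
        exact (measure_mono hsub).trans (measure_biUnion_le _ hcount _)
    _ = ENNReal.ofReal (4 ^ n) * W * ∑' a : u, c * ENNReal.ofReal (r a ^ n) := by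
        simp only [hvol, ENNReal.tsum_mul_left]
        ring
    _ ≤ ENNReal.ofReal (4 ^ n) * W *
        ∑' a : u, ∫⁻ y in Metric.ball (a : EuclideanSpace ℝ (Fin n)) (r a), F y := by
        gcongr with a
        exact hr a (huS a.2)
    _ = ENNReal.ofReal (4 ^ n) * W * ∫⁻ y in ⋃ a ∈ u, Metric.ball a (r a), F y := by
        rw [lintegral_biUnion hcount (fun a _ => measurableSet_ball) hdisj']
    _ ≤ _ := by
        gcongr
        exact (setLIntegral_le_lintegral _ _).trans hJ

/-- Upper rearrangement estimate for the maximal function. -/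
theorem exists_rearr_maximalFn_le (hn : 1 ≤ n) (hΦ : ClassB n Φ) :
    ∃ K : ℝ≥0, 0 < K ∧ ∀ f : EuclideanSpace ℝ (Fin n) → ℂ, AEMeasurable f volume →
      ∀ t, 0 < t → rearr volume (maximalFn Φ f) t ≤ K * supOp Φ f t := by
  obtain ⟨A, hA, hQ⟩ := hΦ.exists_mul_pow_le hn
  set W := (volume (Metric.ball (0 : EuclideanSpace ℝ (Fin n)) 1)).toNNReal with hWdef
  have hW : (W : ℝ≥0∞) = volume (Metric.ball (0 : EuclideanSpace ℝ (Fin n)) 1) :=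
    ENNReal.coe_toNNReal measure_ball_lt_top.ne
  have hW0 : 0 < W := by
    rw [← ENNReal.coe_pos, hW]
    exact Metric.measure_ball_pos _ _ one_pos
  -- `b ≥ W` makes `b rⁿ` at least the volume of an `r`-ball; `b > 1` gives `t < b rⁿ` for `rⁿ ≥ t`,
  -- as the strict supremum in `supOp` requires.
  set b : ℝ := max (W : ℝ) 1 + 1
  have hb : 1 < b := by
    have := le_max_right (W : ℝ) 1
    simp only [b]; linarith
  have hWb : (W : ℝ) ≤ b := by
    have := le_max_left (W : ℝ) 1
    simp only [b]; linarith
  have hb0 : 0 < b := one_pos.trans hb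
  obtain ⟨C, hC, hcmp⟩ := hΦ.exists_comparison hn (a := 1) (b := b ^ (1 / (n : ℝ))) one_pos
    (by positivity)
  have hcmp' : ∀ r, 0 < r → ENNReal.ofReal (Φ r) ≤
      C * ENNReal.ofReal (Φ ((b * r ^ n) ^ (1 / (n : ℝ)))) := fun r hr => by
    have := hcmp r hr
    rwa [one_mul, ← pow_rpow_inv hn hr.le, ← Real.mul_rpow hb0.le (by positivity),
      pow_rpow_inv hn hr.le] at this
  -- Chosen to cancel the constant of the covering step, so that the final measure bound is exactly
  -- `t`.
  set L : ℝ≥0 := 4 ^ n * W * A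
  have hL : 0 < L := by positivity
  refine ⟨C + (L * C + W * A * C), by positivity, fun f hf t ht => ?_⟩
  set F : EuclideanSpace ℝ (Fin n) → ℝ≥0∞ := fun x => ‖f x‖ₑ
  have hF : AEMeasurable F volume := hf.enorm
  set T := supOp Φ f t
  rcases eq_or_ne T ⊤ with hT | hT
  · rw [hT, ENNReal.mul_top (by positivity)]; exact le_top
  set ρ := t ^ (1 / (n : ℝ))
  have hρ : 0 < ρ := by positivity
  have hρn : ρ ^ n = t := rpow_inv_pow hn ht.le
  have hφρ : ENNReal.ofReal (Φ ρ) ≠ 0 := by simpa using hΦ.pos ρ hρ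
  set I := ∫⁻ s in Ioo 0 t, rearr volume F s with hI
  -- Balls of radius at least `ρ = t^(1/n)` never contribute more than `C T`, so only small radii
  -- need a covering argument.
  have hlarge : ∀ r, ρ ≤ r → ENNReal.ofReal (Φ r) * ∫⁻ s in Ioo 0 (b * r ^ n), rearr volume F s ≤
      C * T := by
    intro r hr
    have hr0 := hρ.trans_le hr
    have hlt : t < b * r ^ n := by
      have h1 : t ≤ r ^ n := hρn.symm.trans_le (pow_le_pow_left₀ hρ.le hr n)
      nlinarith
    calc _ ≤ C * ENNReal.ofReal (Φ ((b * r ^ n) ^ (1 / (n : ℝ)))) *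
          ∫⁻ s in Ioo 0 (b * r ^ n), rearr volume F s := by gcongr; exact hcmp' r hr0
      _ ≤ C * T := by
          rw [mul_assoc]
          gcongr
          exact le_supOp hΦ f ht.le hlt
  have hIT : ENNReal.ofReal (Φ ρ) * I ≤ C * T := by
    refine (mul_le_mul_right (lintegral_mono_set (Ioo_subset_Ioo_right ?_)) _).trans
      (hlarge ρ le_rfl)
    rw [hρn]; nlinarith
  have hItop : I ≠ ⊤ := by
    intro h
    rw [h, ENNReal.mul_top hφρ, top_le_iff] at hIT
    exact ENNReal.mul_ne_top ENNReal.coe_ne_top hT hIT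
  have htI : rearr volume F t * ENNReal.ofReal t ≤ I := by
    calc rearr volume F t * ENNReal.ofReal t = ∫⁻ _ in Ioo 0 t, rearr volume F t := by simp
      _ ≤ I := setLIntegral_mono' measurableSet_Ioo fun s hs => antitone_rearr F hs.2.le
  -- Split `F` at height `F*(t)`: the upper part has integral at most `I`, and the bounded part is
  -- handled by the quasi-monotonicity of `Φ(r) rⁿ`.
  set G : Set (EuclideanSpace ℝ (Fin n)) := {x | rearr volume F t < F x}
  have hG : NullMeasurableSet G volume := nullMeasurableSet_lt aemeasurable_const hF
  have hGI : ∫⁻ x in G, F x ≤ I := by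
    refine (setLIntegral_le_rearr hF G).trans ?_
    rw [hI, ← initSeg_ofReal]
    exact lintegral_mono_set (initSeg_mono (measure_rearr_lt_le F t))
  rw [rearr_le_iff]
  set S := {x | ((C + (L * C + W * A * C) : ℝ≥0) : ℝ≥0∞) * T < maximalFn Φ f x} with hS
  -- The three summands of the constant: `C` excludes large radii, `W A C` absorbs the bounded part
  -- of `F`, and `L C` is left for the part on `G`.
  have hpt : ∀ x ∈ S, ∃ r, 0 < r ∧ r ≤ ρ ∧
      L * C * T < ENNReal.ofReal (Φ r) * ∫⁻ y in Metric.ball x r, G.indicator F y := by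
    intro x hx
    obtain ⟨r, hr⟩ := lt_iSup_iff.1 (show _ < maximalFn Φ f x from hx)
    obtain ⟨hr0, hr⟩ := lt_iSup_iff.1 hr
    have hrρ : r < ρ := by
      by_contra! hle
      refine hr.not_ge ?_
      calc ENNReal.ofReal (Φ r) * ∫⁻ y in Metric.ball x r, F y
          ≤ ENNReal.ofReal (Φ r) * ∫⁻ s in Ioo 0 (b * r ^ n), rearr volume F s := by
            gcongr
            refine (setLIntegral_ball_le_rearr hn hF x hr0.le).trans
              (lintegral_mono_set (Ioo_subset_Ioo_right ?_))
            gcongr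
            exact hWb
        _ ≤ C * T := hlarge r hle
        _ ≤ _ := by
            gcongr
            exact le_self_add
    refine ⟨r, hr0, hrρ.le, ?_⟩
    have hsplit : ∫⁻ y in Metric.ball x r, F y ≤
        (∫⁻ y in Metric.ball x r, G.indicator F y) +
          rearr volume F t * (ENNReal.ofReal (r ^ n) * W) := by
      calc ∫⁻ y in Metric.ball x r, F y
          ≤ ∫⁻ y in Metric.ball x r, (G.indicator F y + rearr volume F t) := by
            refine lintegral_mono fun y => ?_
            by_cases hy : y ∈ G
            · rw [indicator_of_mem hy]; exact le_self_add
            · rw [indicator_of_notMem hy, zero_add]; exact not_lt.1 hy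
        _ = _ := by
            rw [lintegral_add_right _ measurable_const, setLIntegral_const,
              volume_ball_eq hn x hr0.le, hW]
    have hrest : ENNReal.ofReal (Φ r) * (rearr volume F t * (ENNReal.ofReal (r ^ n) * W)) ≤
        W * A * C * T := by
      calc _ = W * rearr volume F t * (ENNReal.ofReal (Φ r) * ENNReal.ofReal (r ^ n)) := by ring
        _ ≤ W * rearr volume F t * (A * (ENNReal.ofReal (Φ ρ) * ENNReal.ofReal (ρ ^ n))) := by
            exact mul_le_mul_right (hQ r ρ hr0 hrρ.le) _
        _ = W * A * (ENNReal.ofReal (Φ ρ) * (rearr volume F t * ENNReal.ofReal t)) := by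
            rw [hρn]; ring
        _ ≤ W * A * (C * T) := by
            exact mul_le_mul_right ((mul_le_mul_right htI _).trans hIT) _
        _ = _ := by ring
    have h1 : (L * C * T : ℝ≥0∞) + W * A * C * T <
        ENNReal.ofReal (Φ r) * (∫⁻ y in Metric.ball x r, G.indicator F y) + W * A * C * T := by
      calc (L * C * T : ℝ≥0∞) + W * A * C * T ≤ ((C + (L * C + W * A * C) : ℝ≥0) : ℝ≥0∞) * T := by
            push_cast
            rw [add_mul, add_mul]
            exact le_add_self
        _ < _ := hr
        _ ≤ ENNReal.ofReal (Φ r) * ((∫⁻ y in Metric.ball x r, G.indicator F y) +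
            rearr volume F t * (ENNReal.ofReal (r ^ n) * W)) := by gcongr
        _ ≤ _ := by
            rw [mul_add]
            gcongr
    exact lt_of_add_lt_add_right h1
  have hGint : ∫⁻ x, G.indicator F x ≤ I := by
    rw [lintegral_indicator₀ hG]; exact hGI
  -- The covering bound is divided by `L I` at the end.
  rcases eq_or_ne I 0 with hI0 | hI0
  · have : S = ∅ := by
      refine eq_empty_of_forall_notMem fun x hx => ?_
      obtain ⟨r, -, -, hr⟩ := hpt x hx
      have h0 : ∫⁻ y in Metric.ball x r, G.indicator F y = 0 :=
        nonpos_iff_eq_zero.1 ((setLIntegral_le_lintegral _ _).trans (hGint.trans hI0.le))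
      rw [h0, mul_zero] at hr
      exact not_lt_bot hr
    rw [this, measure_empty]; exact bot_le
  have hvit := measure_le_of_forall_exists_ball hn (S := S) (ρ := ρ) (c := L * I)
    (F := fun y => A * ENNReal.ofReal t * G.indicator F y) (J := A * ENNReal.ofReal t * I)
    (by
      rw [lintegral_const_mul' _ _ (ENNReal.mul_ne_top ENNReal.coe_ne_top ENNReal.ofReal_ne_top)]
      gcongr) (by
      intro x hx
      obtain ⟨r, hr0, hrρ, hr⟩ := hpt x hx
      refine ⟨r, hr0, hrρ, ?_⟩
      rw [lintegral_const_mul' _ _ (ENNReal.mul_ne_top ENNReal.coe_ne_top ENNReal.ofReal_ne_top)]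
      rw [← ENNReal.mul_le_mul_iff_right hφρ ENNReal.ofReal_ne_top]
      calc ENNReal.ofReal (Φ ρ) * (L * I * ENNReal.ofReal (r ^ n))
          = L * (ENNReal.ofReal (Φ ρ) * I) * ENNReal.ofReal (r ^ n) := by ring
        _ ≤ L * (C * T) * ENNReal.ofReal (r ^ n) := by gcongr
        _ = (L * C * T) * ENNReal.ofReal (r ^ n) := by ring
        _ ≤ ENNReal.ofReal (Φ r) * (∫⁻ y in Metric.ball x r, G.indicator F y) *
            ENNReal.ofReal (r ^ n) := by gcongr
        _ = (ENNReal.ofReal (Φ r) * ENNReal.ofReal (r ^ n)) *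
            ∫⁻ y in Metric.ball x r, G.indicator F y := by ring
        _ ≤ (A * (ENNReal.ofReal (Φ ρ) * ENNReal.ofReal (ρ ^ n))) *
            ∫⁻ y in Metric.ball x r, G.indicator F y := by
            exact mul_le_mul_left (hQ r ρ hr0 hrρ) _
        _ = _ := by rw [hρn]; ring)
  have hLI0 : (L : ℝ≥0∞) * I ≠ 0 := mul_ne_zero (by simpa using hL.ne') hI0
  have hLIt : (L : ℝ≥0∞) * I ≠ ⊤ := ENNReal.mul_ne_top ENNReal.coe_ne_top hItop
  rw [← ENNReal.mul_le_mul_iff_right hLI0 hLIt]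
  refine hvit.trans_eq ?_
  rw [← hW]
  have h4 : ENNReal.ofReal (4 ^ n) = 4 ^ n := by
    rw [ENNReal.ofReal_pow (by norm_num)]; norm_num
  rw [h4]
  simp only [L]
  push_cast
  ring

/-- Integration in the volume variable `ω ‖x‖ⁿ`. For a strictly radially decreasing `v`, the set `{v
> v x}` is the ball of radius `‖x‖`, so `map_measure_lt_toReal` is the change of variables. -/
theorem setLIntegral_ball_radial (hn : 1 ≤ n) {ψ : ℝ → ℝ≥0∞} (hψ : Measurable ψ) {R : ℝ}
    (hR : 0 < R) :
    ∫⁻ x in Metric.ball (0 : EuclideanSpace ℝ (Fin n)) R,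
        ψ ((volume (Metric.ball (0 : EuclideanSpace ℝ (Fin n)) 1)).toReal * ‖x‖ ^ n) =
      ∫⁻ s in Ioo 0 ((volume (Metric.ball (0 : EuclideanSpace ℝ (Fin n)) 1)).toReal * R ^ n),
        ψ s := by
  have : Nonempty (Fin n) := ⟨⟨0, hn⟩⟩
  set ω := (volume (Metric.ball (0 : EuclideanSpace ℝ (Fin n)) 1)).toReal
  set B := Metric.ball (0 : EuclideanSpace ℝ (Fin n)) R
  set v : EuclideanSpace ℝ (Fin n) → ℝ≥0∞ := fun x => ENNReal.ofReal (1 / (1 + ‖x‖))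
  have hv : Measurable v := by fun_prop
  have hpos : ∀ x, 0 < v x := fun x => by simp only [v, ENNReal.ofReal_pos]; positivity
  have hvlt : ∀ x z, v x < v z ↔ ‖z‖ < ‖x‖ := fun x z => by
    simp only [v]
    rw [ENNReal.ofReal_lt_ofReal_iff (by positivity),
      one_div_lt_one_div (by positivity) (by positivity)]
    exact add_lt_add_iff_left 1
  have hnull : ∀ y, 0 < y → volume.restrict B {x | v x = y} = 0 := by
    intro y _
    refine Measure.absolutelyContinuous_of_le Measure.restrict_le_self ?_
    rcases eq_empty_or_nonempty {x | v x = y} with h | ⟨z, hz⟩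
    · rw [h, measure_empty]
    · refine measure_mono_null (fun x hx => ?_) (Measure.addHaar_sphere volume 0 ‖z‖)
      rw [mem_sphere_zero_iff_norm]
      have hxz : v x = v z := hx.trans hz.symm
      exact le_antisymm (not_lt.1 fun h => ((hvlt _ _).2 h).ne hxz)
        (not_lt.1 fun h => ((hvlt _ _).2 h).ne' hxz)
  have : IsFiniteMeasure (volume.restrict B) :=
    ⟨by simpa using (measure_ball_lt_top (μ := volume))⟩
  obtain ⟨hσ, hmap⟩ := map_measure_lt_toReal (volume.restrict B) hv hnull (ae_of_all _ hpos)
  have hB : (volume.restrict B univ).toReal = ω * R ^ n := by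
    rw [Measure.restrict_apply_univ, volume_ball_eq_ofReal hn _ hR.le, ENNReal.toReal_ofReal]
    positivity
  rw [hB] at hmap
  rw [← hmap, lintegral_map hψ hσ]
  refine setLIntegral_congr_fun measurableSet_ball fun x hx => ?_
  have hx' : ‖x‖ < R := mem_ball_zero_iff.1 hx
  have hset : {z | v x < v z} = Metric.ball 0 ‖x‖ := by
    ext z
    rw [mem_ball_zero_iff]
    exact hvlt x z
  have hσx : (volume.restrict B {z | v x < v z}).toReal = ω * ‖x‖ ^ n := by
    rw [hset, Measure.restrict_apply measurableSet_ball,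
      inter_eq_self_of_subset_left (Metric.ball_subset_ball hx'.le),
      volume_ball_eq_ofReal hn _ (norm_nonneg x), ENNReal.toReal_ofReal]
    positivity
  rw [hσx]

/-- The radially nonincreasing function with the same rearrangement as `f`. -/
theorem exists_radial_rearr (hn : 1 ≤ n) {F : EuclideanSpace ℝ (Fin n) → ℝ≥0∞}
    (hfin : ∀ t, 0 < t → rearr volume F t < ⊤) :
    ∃ f : EuclideanSpace ℝ (Fin n) → ℂ, Measurable f ∧
      (∀ t, 0 < t → rearr volume (fun x => ‖f x‖ₑ) t ≤ rearr volume F t) ∧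
      ∀ R, 0 < R → ∫⁻ s in
        Ioo 0 ((volume (Metric.ball (0 : EuclideanSpace ℝ (Fin n)) 1)).toReal * R ^ n),
          rearr volume F s ≤ ∫⁻ x in Metric.ball 0 R, ‖f x‖ₑ := by
  have : Nonempty (Fin n) := ⟨⟨0, hn⟩⟩
  set ω := (volume (Metric.ball (0 : EuclideanSpace ℝ (Fin n)) 1)).toReal
  have hω : 0 < ω := unitBall_toReal_pos
  have hσm : Measurable fun x : EuclideanSpace ℝ (Fin n) => ω * ‖x‖ ^ n := by fun_prop
  set f : EuclideanSpace ℝ (Fin n) → ℂ := fun x =>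
    (((rearr volume F (ω * ‖x‖ ^ n)).toReal : ℝ) : ℂ)
  -- Only at the origin can the rearrangement be infinite and `toReal` lose its value.
  have hfx : ∀ x, x ≠ 0 → ‖f x‖ₑ = rearr volume F (ω * ‖x‖ ^ n) := fun x hx => by
    have : 0 < ‖x‖ := norm_pos_iff.2 hx
    exact enorm_ofReal_toReal (hfin _ (by positivity))
  have hae : ∀ᵐ x : EuclideanSpace ℝ (Fin n), x ≠ 0 := by
    rw [ae_iff]
    simp
  refine ⟨f, ?_, fun t ht => ?_, fun R hR => ?_⟩
  · exact Complex.measurable_ofReal.comp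
      (ENNReal.measurable_toReal.comp ((measurable_rearr F).comp hσm))
  · rw [rearr_le_iff]
    set R := (t / ω) ^ (1 / (n : ℝ))
    have hRn : ω * R ^ n = t := by
      rw [rpow_inv_pow hn (by positivity)]; field_simp
    calc volume {x | rearr volume F t < ‖f x‖ₑ}
        ≤ volume (Metric.ball (0 : EuclideanSpace ℝ (Fin n)) R) := by
          refine measure_mono_ae ?_
          filter_upwards [hae] with x hx hlt
          change x ∈ Metric.ball (0 : EuclideanSpace ℝ (Fin n)) R
          rw [mem_ball_zero_iff]
          by_contra! hle
          have hlt' : rearr volume F t < ‖f x‖ₑ := hlt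
          rw [hfx x hx] at hlt'
          refine hlt'.not_ge (antitone_rearr F ?_)
          rw [← hRn]
          gcongr
      _ = ENNReal.ofReal t := by
          rw [volume_ball_eq_ofReal hn _ (by positivity), hRn]
  · rw [← setLIntegral_ball_radial hn (measurable_rearr F) hR]
    refine (lintegral_congr_ae (ae_restrict_of_ae ?_)).le
    filter_upwards [hae] with x hx
    rw [hfx x hx]

/-- Lower rearrangement estimate for the maximal function. -/
theorem exists_supOp_le_rearr_maximalFn (hn : 1 ≤ n) (hΦ : ClassB n Φ) :
    ∃ K : ℝ≥0, 0 < K ∧ ∀ f : EuclideanSpace ℝ (Fin n) → ℂ,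
      (∀ t, 0 < t → rearr volume (fun x => ‖f x‖ₑ) t < ⊤) →
      ∃ g : EuclideanSpace ℝ (Fin n) → ℂ, Measurable g ∧
        (∀ t, 0 < t → rearr volume (fun x => ‖g x‖ₑ) t ≤ rearr volume (fun x => ‖f x‖ₑ) t) ∧
        ∀ t, 0 < t → supOp Φ f t ≤ K * rearr volume (maximalFn Φ g) t := by
  set ω := (volume (Metric.ball (0 : EuclideanSpace ℝ (Fin n)) 1)).toReal
  have hω : 0 < ω := unitBall_toReal_pos
  obtain ⟨K, hK, hcmp⟩ := hΦ.exists_comparison hn (a := ω ^ (1 / (n : ℝ))) (b := 2)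
    (by positivity) two_pos
  refine ⟨K, hK, fun f hfin => ?_⟩
  obtain ⟨g, hg, hle, hball⟩ := exists_radial_rearr hn hfin
  refine ⟨g, hg, hle, fun τ hτ => ?_⟩
  rw [supOp_le_iff hΦ f hτ.le]
  intro t hτt
  have ht := hτ.trans hτt
  set R := (t / ω) ^ (1 / (n : ℝ)) with hR
  have hR0 : 0 < R := by positivity
  have hRn : ω * R ^ n = t := by
    rw [rpow_inv_pow hn (by positivity)]; field_simp
  have htR : t ^ (1 / (n : ℝ)) = ω ^ (1 / (n : ℝ)) * R := by
    rw [hR, ← Real.mul_rpow hω.le (by positivity)]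
    congr 1
    field_simp
  set I := ∫⁻ s in Ioo 0 t, rearr volume (fun x => ‖f x‖ₑ) s
  have hI : I ≤ ∫⁻ x in Metric.ball 0 R, ‖g x‖ₑ := by
    have := hball R hR0
    rwa [hRn] at this
  -- Every `x` in the ball of radius `R` about `0` has that ball inside its own `2R`-ball; the ball
  -- has volume `t > τ`, so the lower bound survives rearrangement.
  have hlow : ENNReal.ofReal (Φ (2 * R)) * I ≤ rearr volume (maximalFn Φ g) τ := by
    refine le_of_forall_lt fun y hy => ?_
    rw [lt_rearr_iff]
    calc ENNReal.ofReal τ < ENNReal.ofReal t := (ENNReal.ofReal_lt_ofReal_iff ht).2 hτt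
      _ = volume (Metric.ball (0 : EuclideanSpace ℝ (Fin n)) R) := by
          rw [volume_ball_eq_ofReal hn _ hR0.le, hRn]
      _ ≤ _ := by
          refine measure_mono fun x hx => hy.trans_le ?_
          refine le_iSup_of_le (2 * R) (le_iSup_of_le (by positivity) ?_)
          refine mul_le_mul_right (hI.trans (lintegral_mono_set (Metric.ball_subset_ball' ?_))) _
          rw [dist_comm]
          linarith [Metric.mem_ball.1 hx]
  calc ENNReal.ofReal (Φ (t ^ (1 / (n : ℝ)))) * I
      ≤ K * ENNReal.ofReal (Φ (2 * R)) * I := by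
        rw [htR]
        gcongr
        exact hcmp R hR0
    _ ≤ _ := by
        rw [mul_assoc]
        gcongr

end Maximal

/-! ### The space dual to a functional, and finiteness of rearrangements. -/

variable {n : ℕ}

theorem lintegral_mul_rearr_const_mul {α β : Type*} [MeasurableSpace α] [MeasurableSpace β]
    {μ : Measure α} {ν : Measure β} (f : α → ℝ≥0∞) (a : ℝ≥0) (w : β → ℝ≥0∞) :
    ∫⁻ t in Ioi (0 : ℝ), rearr μ f t * rearr ν (fun x => (a : ℝ≥0∞) * w x) t =
      a * ∫⁻ t in Ioi (0 : ℝ), rearr μ f t * rearr ν w t := by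
  rw [← lintegral_const_mul' _ _ ENNReal.coe_ne_top]
  refine lintegral_congr fun t => ?_
  rw [rearr_const_mul]
  ring

/-- The rearrangement-invariant space dual to a functional `N`, with norm
`sup {∫ f* w* : N w ≤ 1}`. -/
noncomputable def dualRIS (N : (EuclideanSpace ℝ (Fin n) → ℝ≥0∞) → ℝ≥0∞)
    (hind : ∀ s : Set (EuclideanSpace ℝ (Fin n)), MeasurableSet s → 0 < volume s → volume s < ∞ →
      ∃ c : ℝ≥0, 0 < c ∧ N (fun x => c * s.indicator 1 x) ≤ 1)
    (hloc : ∀ s : Set (EuclideanSpace ℝ (Fin n)), MeasurableSet s → 0 < volume s → volume s < ∞ →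
      ∃ c : ℝ≥0, ∀ w, AEMeasurable w volume → N w ≤ 1 →
        ∫⁻ t in initSeg (volume s), rearr volume w t ≤ c) : RIS n :=
  have hle : ∀ s : Set (EuclideanSpace ℝ (Fin n)), MeasurableSet s → 0 < volume s → volume s < ∞ →
      ∃ c : ℝ≥0, ∀ f, AEMeasurable f volume → ∫⁻ x in s, f x ≤
        c * ⨆ (w : EuclideanSpace ℝ (Fin n) → ℝ≥0∞) (_ : AEMeasurable w volume) (_ : N w ≤ 1),
          ∫⁻ t in Ioi (0 : ℝ), rearr volume f t * rearr volume w t := by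
    intro s hs h0 ht
    obtain ⟨c, hc, hN⟩ := hind s hs h0 ht
    refine ⟨c⁻¹, fun f hf => ?_⟩
    have hm : AEMeasurable (fun x => (c : ℝ≥0∞) * s.indicator 1 x) volume :=
      ((measurable_one.indicator hs).const_mul _).aemeasurable
    have h1 : (c : ℝ≥0∞) * ∫⁻ x in s, f x ≤
        ⨆ (w : EuclideanSpace ℝ (Fin n) → ℝ≥0∞) (_ : AEMeasurable w volume) (_ : N w ≤ 1),
          ∫⁻ t in Ioi (0 : ℝ), rearr volume f t * rearr volume w t := by
      refine le_iSup_of_le _ (le_iSup_of_le hm (le_iSup_of_le hN ?_))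
      rw [lintegral_mul_rearr_const_mul]
      simp only [mul_comm (rearr volume f _)]
      rw [lintegral_rearr_indicator_one_mul]
      gcongr
      exact setLIntegral_le_rearr hf s
    have hc' : (c : ℝ≥0∞) ≠ 0 := by simpa using hc.ne'
    calc ∫⁻ x in s, f x = ((c⁻¹ : ℝ≥0) : ℝ≥0∞) * (c * ∫⁻ x in s, f x) := by
          rw [← mul_assoc, ENNReal.coe_inv hc.ne', ENNReal.inv_mul_cancel hc' ENNReal.coe_ne_top,
            one_mul]
      _ ≤ _ := by gcongr
  have hrm : ∀ f g : EuclideanSpace ℝ (Fin n) → ℝ≥0∞,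
      (∀ t : ℝ, 0 < t → rearr volume f t ≤ rearr volume g t) →
      (⨆ (w : EuclideanSpace ℝ (Fin n) → ℝ≥0∞) (_ : AEMeasurable w volume) (_ : N w ≤ 1),
          ∫⁻ t in Ioi (0 : ℝ), rearr volume f t * rearr volume w t) ≤
      ⨆ (w : EuclideanSpace ℝ (Fin n) → ℝ≥0∞) (_ : AEMeasurable w volume) (_ : N w ≤ 1),
          ∫⁻ t in Ioi (0 : ℝ), rearr volume g t * rearr volume w t := fun f g h =>
    iSup_mono fun w => iSup_mono fun _ => iSup_mono fun _ =>
      setLIntegral_mono' measurableSet_Ioi fun t ht => mul_le_mul_left (h t ht) _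
  { ρ := fun f => ⨆ (w : EuclideanSpace ℝ (Fin n) → ℝ≥0∞) (_ : AEMeasurable w volume)
      (_ : N w ≤ 1), ∫⁻ t in Ioi (0 : ℝ), rearr volume f t * rearr volume w t
    eq_zero_iff := by
      intro f hf
      constructor
      · intro h0
        have h1 : ∀ k : ℕ, ∀ᵐ x, x ∈ Metric.ball (0 : EuclideanSpace ℝ (Fin n)) ((k : ℝ) + 1) →
            f x = 0 := by
          intro k
          rw [← ae_restrict_iff' measurableSet_ball]
          obtain ⟨c, hc⟩ := hle _ measurableSet_ball (RIS.volume_ball_pos k)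
            measure_ball_lt_top
          have := hc f hf
          rw [h0, mul_zero, nonpos_iff_eq_zero, lintegral_eq_zero_iff' hf.restrict] at this
          exact this
        filter_upwards [ae_all_iff.2 h1] with x hx
        obtain ⟨k, hk⟩ := exists_nat_gt ‖x‖
        exact hx k (by rw [mem_ball_zero_iff]; linarith)
      · intro h0
        rw [← nonpos_iff_eq_zero]
        refine iSup_le fun w => iSup_le fun _ => iSup_le fun _ => ?_
        rw [rearr_congr_ae h0]
        have : ∀ t, rearr volume (0 : EuclideanSpace ℝ (Fin n) → ℝ≥0∞) t = 0 := rearr_zero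
        simp [this]
    smul := by
      intro a f hf
      simp only [ENNReal.mul_iSup]
      refine iSup_congr fun w => iSup_congr fun _ => iSup_congr fun _ => ?_
      simp only [mul_comm _ (rearr volume w _)]
      exact lintegral_mul_rearr_const_mul _ _ _
    add_le := by
      intro f g hf hg
      refine iSup_le fun w => iSup_le fun hw => iSup_le fun hN => ?_
      refine (lintegral_rearr_add_mul_le hf hg ((antitone_rearr w).antitoneOn _)).trans ?_
      exact add_le_add (le_iSup_of_le w (le_iSup_of_le hw (le_iSup_of_le hN le_rfl)))
        (le_iSup_of_le w (le_iSup_of_le hw (le_iSup_of_le hN le_rfl)))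
    mono := fun f g _ _ h => hrm f g fun t _ => rearr_mono_ae h t
    fatou := by
      intro F f hF hf hmono hlim
      have hsup : ∀ᵐ x, f x = ⨆ k, F k x := by
        filter_upwards [hlim, ae_all_iff.2 hmono] with x hx hx'
        exact tendsto_nhds_unique hx (tendsto_atTop_iSup (monotone_nat_of_le_succ hx'))
      have key : (⨆ (w : EuclideanSpace ℝ (Fin n) → ℝ≥0∞) (_ : AEMeasurable w volume)
          (_ : N w ≤ 1), ∫⁻ t in Ioi (0 : ℝ), rearr volume f t * rearr volume w t) =
          ⨆ k, ⨆ (w : EuclideanSpace ℝ (Fin n) → ℝ≥0∞) (_ : AEMeasurable w volume)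
          (_ : N w ≤ 1), ∫⁻ t in Ioi (0 : ℝ), rearr volume (F k) t * rearr volume w t := by
        refine (iSup_congr fun w => iSup_congr fun _ => iSup_congr fun _ =>
          lintegral_rearr_iSup_mul hmono hsup (measurable_rearr w).aemeasurable).trans ?_
        refine le_antisymm ?_ ?_
        · exact iSup_le fun w => iSup_le fun hw => iSup_le fun hN => iSup_le fun k =>
            le_iSup_of_le k (le_iSup_of_le w (le_iSup_of_le hw (le_iSup_of_le hN le_rfl)))
        · exact iSup_le fun k => iSup_le fun w => iSup_le fun hw => iSup_le fun hN =>
            le_iSup_of_le w (le_iSup_of_le hw (le_iSup_of_le hN (le_iSup_of_le k le_rfl)))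
      rw [key]
      exact tendsto_atTop_iSup (monotone_nat_of_le_succ fun k =>
        hrm _ _ fun t _ => rearr_mono_ae (hmono k) t)
    local_integrable := hle
    indicator_lt_top := by
      intro s hs h0 ht
      obtain ⟨c, hc⟩ := hloc s hs h0 ht
      refine lt_of_le_of_lt (b := (c : ℝ≥0∞)) ?_ ENNReal.coe_lt_top
      refine iSup_le fun w => iSup_le fun hw => iSup_le fun hN => ?_
      rw [lintegral_rearr_indicator_one_mul]
      exact hc w hw hN
    rearr_mono := fun f g _ _ h => hrm f g h }

/-- If `F*(t) = ∞`, then `F*` dominates the rearrangement of every multiple of the indicator of a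
ball of volume `t`, which makes the norm of `F` infinite. -/
theorem RIS.rearr_lt_top (X : RIS n) (hn : 1 ≤ n) {F : EuclideanSpace ℝ (Fin n) → ℝ≥0∞}
    (hF : AEMeasurable F volume) (hfin : X.ρ F < ⊤) {t : ℝ} (ht : 0 < t) :
    rearr volume F t < ⊤ := by
  have : Nonempty (Fin n) := ⟨⟨0, hn⟩⟩
  by_contra! htop
  rw [top_le_iff] at htop
  set ω := (volume (Metric.ball (0 : EuclideanSpace ℝ (Fin n)) 1)).toReal
  have hω : 0 < ω := unitBall_toReal_pos
  set B := Metric.ball (0 : EuclideanSpace ℝ (Fin n)) ((t / ω) ^ (1 / (n : ℝ)))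
  have hB : volume B = ENNReal.ofReal t := by
    rw [volume_ball_eq_ofReal hn _ (by positivity), rpow_inv_pow hn (by positivity)]
    congr 1
    change ω * _ = _
    field_simp
  have hm : AEMeasurable (B.indicator (1 : EuclideanSpace ℝ (Fin n) → ℝ≥0∞)) volume :=
    (measurable_one.indicator measurableSet_ball).aemeasurable
  have hle : ∀ c : ℝ≥0, c * X.ρ (B.indicator 1) ≤ X.ρ F := by
    intro c
    rw [← X.smul _ _ hm]
    refine X.rearr_mono _ _ (hm.const_mul _) hF fun s hs => ?_
    rw [rearr_const_mul, rearr_indicator_one]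
    by_cases hst : ENNReal.ofReal s < volume B
    · rw [hB, ENNReal.ofReal_lt_ofReal_iff ht] at hst
      have : rearr volume F s = ⊤ := top_le_iff.1 (htop ▸ antitone_rearr F hst.le)
      rw [this]; exact le_top
    · rw [indicator_of_notMem (by exact hst), mul_zero]; exact bot_le
  have hpos : X.ρ (B.indicator 1) ≠ 0 := by
    intro h0
    rw [X.eq_zero_iff _ hm] at h0
    have h1 : volume B = 0 := by
      refine measure_mono_null (fun x hx => ?_) (ae_iff.1 h0)
      simp [hx]
    rw [hB] at h1
    simp only [ENNReal.ofReal_eq_zero] at h1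
    linarith
  obtain ⟨m, hm⟩ := ENNReal.exists_nat_mul_gt hpos hfin.ne
  exact (hle m).not_gt (by exact_mod_cast hm)

/-- The formula `supFormula`, for nonnegative functions. -/
noncomputable def assocFormula (Φ : ℝ → ℝ) (E : RIS n) (w : EuclideanSpace ℝ (Fin n) → ℝ≥0∞) :
    ℝ≥0∞ :=
  ⨆ (f : EuclideanSpace ℝ (Fin n) → ℂ) (_ : E.Mem f) (_ : E.norm f ≠ 0),
    (∫⁻ τ in Ioi (0 : ℝ), rearr volume w τ * supOp Φ f τ) / E.norm f

theorem supFormula_eq (Φ : ℝ → ℝ) (E : RIS n) (g : EuclideanSpace ℝ (Fin n) → ℂ) :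
    supFormula Φ E g = assocFormula Φ E fun x => ‖g x‖ₑ := rfl

/-! ### The functional `assocFormula` and its dual space. -/

section

variable {Φ : ℝ → ℝ} {E : RIS n}

theorem assocFormula_const_mul (a : ℝ≥0) (w : EuclideanSpace ℝ (Fin n) → ℝ≥0∞) :
    assocFormula Φ E (fun x => a * w x) = a * assocFormula Φ E w := by
  simp only [assocFormula, ENNReal.mul_iSup, div_eq_mul_inv]
  refine iSup_congr fun f => iSup_congr fun _ => iSup_congr fun _ => ?_
  rw [← mul_assoc, ← lintegral_const_mul' _ _ ENNReal.coe_ne_top]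
  congr 1
  refine lintegral_congr fun t => ?_
  rw [rearr_const_mul, mul_assoc]

theorem lintegral_rearr_mul_supOp_le {f : EuclideanSpace ℝ (Fin n) → ℂ} (hf : E.Mem f)
    (h0 : E.norm f ≠ 0) (w : EuclideanSpace ℝ (Fin n) → ℝ≥0∞) :
    ∫⁻ τ in Ioi (0 : ℝ), rearr volume w τ * supOp Φ f τ ≤ assocFormula Φ E w * E.norm f := by
  rw [← ENNReal.div_le_iff h0 hf.2.ne]
  exact le_iSup_of_le f (le_iSup_of_le hf (le_iSup_of_le h0 le_rfl))

/-- Replace `f` by its radial competitor `g`, for which `supOp Φ f ≤ K (M_Φ g)*` and `‖g‖_E ≤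
‖f‖_E`; then apply Hölder for rearrangements and the embedding to `M_Φ g`. -/
theorem assocFormula_le_assoc (hn : 1 ≤ n) (hΦ : ClassB n Φ) {X : RIS n}
    (hX : MaximalEmbeds Φ E X) :
    ∃ C : ℝ≥0, 0 < C ∧ ∀ w : EuclideanSpace ℝ (Fin n) → ℝ≥0∞, AEMeasurable w volume →
      assocFormula Φ E w ≤ C * X.assoc w := by
  obtain ⟨hmem, C, hC⟩ := hX
  obtain ⟨K, hK, hlow⟩ := exists_supOp_le_rearr_maximalFn hn hΦ
  refine ⟨K * C + 1, by positivity, fun w hw => ?_⟩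
  refine iSup_le fun f => iSup_le fun hf => iSup_le fun h0 => ?_
  obtain ⟨g, hg, hgf, hT⟩ := hlow f fun t ht => E.rearr_lt_top hn hf.1.enorm hf.2 ht
  have hgE : E.norm g ≤ E.norm f := E.rearr_mono _ _ hg.enorm.aemeasurable hf.1.enorm hgf
  have hgm : E.Mem g := ⟨hg.aemeasurable, hgE.trans_lt hf.2⟩
  set u := maximalFn Φ g
  have huS : u ∈ maximalSpace Φ E := ⟨g, hgm, rfl⟩
  have hu : X.ρ u ≤ C * E.norm f := by
    have h1 : X.norm u ≤ C * maximalNorm Φ E u := hC u huS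
    have h2 : maximalNorm Φ E u ≤ E.norm g :=
      iInf_le_of_le g (iInf_le_of_le hgm (iInf_le_of_le rfl le_rfl))
    exact h1.trans (mul_le_mul_right (h2.trans hgE) _)
  have hufin : X.ρ u < ⊤ := (hmem u huS).2
  refine ENNReal.div_le_of_le_mul ?_
  calc ∫⁻ τ in Ioi (0 : ℝ), rearr volume w τ * supOp Φ f τ
      ≤ ∫⁻ τ in Ioi (0 : ℝ), K * (rearr volume w τ * rearr volume u τ) := by
        refine setLIntegral_mono' measurableSet_Ioi fun τ hτ => ?_
        rw [mul_left_comm]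
        exact mul_le_mul_right (hT τ hτ) _
    _ = K * ∫⁻ τ in Ioi (0 : ℝ), rearr volume w τ * rearr volume u τ :=
        lintegral_const_mul' _ _ ENNReal.coe_ne_top
    _ ≤ K * (X.ρ u * X.assoc w) := by
        gcongr
        exact X.lintegral_rearr_mul_rearr_le hn hw (measurable_maximalFn Φ g).aemeasurable
          hufin.ne
    _ ≤ K * (C * E.norm f * X.assoc w) := by gcongr
    _ = (K * C : ℝ≥0) * X.assoc w * E.norm f := by push_cast; ring
    _ ≤ _ := by
        gcongr
        exact le_self_add

theorem exists_assocFormula_indicator_le_one (hn : 1 ≤ n) (hΦ : ClassB n Φ) {X : RIS n}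
    (hX : MaximalEmbeds Φ E X) (s : Set (EuclideanSpace ℝ (Fin n))) (hs : MeasurableSet s)
    (h0 : 0 < volume s) (ht : volume s < ∞) :
    ∃ c : ℝ≥0, 0 < c ∧ assocFormula Φ E (fun x => c * s.indicator 1 x) ≤ 1 := by
  obtain ⟨C, hC, hle⟩ := assocFormula_le_assoc hn hΦ hX
  obtain ⟨c, hc⟩ := X.local_integrable s hs h0 ht
  have h1 : X.assoc (s.indicator 1) ≤ c := by
    refine iSup_le fun h => iSup_le fun hh => iSup_le fun hh1 => ?_
    calc ∫⁻ x, h x * s.indicator 1 x = ∫⁻ x in s, h x := by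
          rw [← lintegral_indicator hs]
          refine lintegral_congr fun x => ?_
          by_cases hx : x ∈ s <;> simp [hx]
      _ ≤ c * X.ρ h := hc h hh
      _ ≤ c * 1 := by gcongr
      _ = c := mul_one _
  refine ⟨(C * c + 1)⁻¹, by positivity, ?_⟩
  rw [assocFormula_const_mul, ENNReal.coe_inv (by positivity)]
  calc _ ≤ (((C * c + 1 : ℝ≥0)) : ℝ≥0∞)⁻¹ * ((C * c + 1 : ℝ≥0) : ℝ≥0∞) := by
        gcongr
        refine (hle _ (measurable_one.indicator hs).aemeasurable).trans ?_
        refine (mul_le_mul_right h1 _).trans ?_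
        push_cast
        exact le_self_add
    _ ≤ 1 := ENNReal.inv_mul_le_one _

/-- Test the formula with the indicator of the unit ball: its `supOp` is nonincreasing and positive
at `|s|`, hence bounded below on `(0, |s|)`. This makes the dual norm finite on indicators. -/
theorem exists_setLIntegral_rearr_le_of_assocFormula_le_one (hΦ : ClassB n Φ) (E : RIS n)
    (s : Set (EuclideanSpace ℝ (Fin n))) (h0 : 0 < volume s) (ht : volume s < ∞) :
    ∃ c : ℝ≥0, ∀ w : EuclideanSpace ℝ (Fin n) → ℝ≥0∞, assocFormula Φ E w ≤ 1 →
      ∫⁻ t in initSeg (volume s), rearr volume w t ≤ c := by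
  set B := Metric.ball (0 : EuclideanSpace ℝ (Fin n)) 1
  have hB0 : 0 < volume B := Metric.measure_ball_pos _ _ one_pos
  set f : EuclideanSpace ℝ (Fin n) → ℂ := B.indicator 1
  have hfm : Measurable f := measurable_one.indicator measurableSet_ball
  have hfe : (fun x => ‖f x‖ₑ) = B.indicator 1 := by
    ext x
    by_cases hx : x ∈ B <;> simp [f, hx]
  have hfE : E.norm f = E.ρ (B.indicator 1) := by rw [RIS.norm, hfe]
  have hf : E.Mem f := ⟨hfm.aemeasurable, by
    rw [hfE]
    exact E.indicator_lt_top B measurableSet_ball hB0 measure_ball_lt_top⟩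
  have hf0 : E.norm f ≠ 0 := by
    rw [RIS.norm]
    intro h
    rw [E.eq_zero_iff _ hfm.enorm.aemeasurable, hfe] at h
    refine hB0.ne' (measure_mono_null (fun x hx => ?_) (ae_iff.1 h))
    simp [show x ∈ B from hx]
  set m := (volume s).toReal
  have hm : 0 < m := ENNReal.toReal_pos h0.ne' ht.ne
  have hpos : 0 < supOp Φ f m := by
    refine lt_of_lt_of_le ?_ (le_supOp hΦ f hm.le (lt_add_one m))
    refine ENNReal.mul_pos ?_ ?_
    · simpa using hΦ.pos _ (by positivity)
    · rw [hfe, ← initSeg_ofReal]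
      refine ne_of_gt (lt_of_lt_of_le (b := volume (initSeg
        (min (volume B) (ENNReal.ofReal (m + 1))))) ?_ ?_)
      · rw [volume_initSeg]
        exact lt_min hB0 (ENNReal.ofReal_pos.2 (by positivity))
      · rw [← setLIntegral_one]
        refine (setLIntegral_mono' (measurableSet_initSeg _) fun t ht => ?_).trans
          (lintegral_mono_set (initSeg_mono (min_le_right _ _)))
        rw [rearr_indicator_one, indicator_of_mem]
        · rfl
        · exact ht.2.trans_le (min_le_left _ _)
  obtain ⟨r, hr0, hr⟩ := ENNReal.lt_iff_exists_nnreal_btwn.1 hpos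
  have hr0' : (r : ℝ≥0∞) ≠ 0 := hr0.ne'
  obtain ⟨e, he⟩ : ∃ e : ℝ≥0, (e : ℝ≥0∞) = E.norm f := ⟨_, ENNReal.coe_toNNReal hf.2.ne⟩
  refine ⟨r⁻¹ * e, fun w hN => ?_⟩
  have hkey : r * ∫⁻ t in initSeg (volume s), rearr volume w t ≤ e := by
    calc r * ∫⁻ t in initSeg (volume s), rearr volume w t
        = ∫⁻ t in initSeg (volume s), r * rearr volume w t :=
          (lintegral_const_mul' _ _ ENNReal.coe_ne_top).symm
      _ ≤ ∫⁻ t in initSeg (volume s), rearr volume w t * supOp Φ f t := by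
          refine setLIntegral_mono' (measurableSet_initSeg _) fun t hts => ?_
          rw [mul_comm]
          refine mul_le_mul_right (hr.le.trans (antitone_supOp Φ f ?_)) _
          rw [initSeg_eq_Ioo ht.ne] at hts
          exact hts.2.le
      _ ≤ ∫⁻ t in Ioi (0 : ℝ), rearr volume w t * supOp Φ f t :=
          lintegral_mono_set (initSeg_subset _)
      _ ≤ assocFormula Φ E w * E.norm f := lintegral_rearr_mul_supOp_le hf hf0 w
      _ ≤ 1 * E.norm f := by gcongr
      _ = e := by rw [one_mul, he]
  rw [ENNReal.coe_mul, ENNReal.coe_inv (by simpa using hr0')]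
  calc ∫⁻ t in initSeg (volume s), rearr volume w t
      = (r : ℝ≥0∞)⁻¹ * (r * ∫⁻ t in initSeg (volume s), rearr volume w t) := by
        rw [← mul_assoc, ENNReal.inv_mul_cancel hr0' ENNReal.coe_ne_top, one_mul]
    _ ≤ _ := by gcongr

/-- A rearrangement-invariant space with the norm `sup {∫ f* w* : N w ≤ 1}`, where `N` is
`assocFormula Φ E`. -/
theorem exists_RIS_ρ_eq_iSup (hn : 1 ≤ n) (hΦ : ClassB n Φ) {X : RIS n}
    (hX : MaximalEmbeds Φ E X) :
    ∃ Y : RIS n, ∀ f, Y.ρ f = ⨆ (w : EuclideanSpace ℝ (Fin n) → ℝ≥0∞)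
      (_ : AEMeasurable w volume) (_ : assocFormula Φ E w ≤ 1),
        ∫⁻ t in Ioi (0 : ℝ), rearr volume f t * rearr volume w t :=
  ⟨dualRIS (assocFormula Φ E) (exists_assocFormula_indicator_le_one hn hΦ hX)
    (fun s _ h0 ht => by
      obtain ⟨c, hc⟩ := exists_setLIntegral_rearr_le_of_assocFormula_le_one hΦ E s h0 ht
      exact ⟨c, fun w _ => hc w⟩), fun _ => rfl⟩

variable {Y : RIS n}

theorem lintegral_rearr_mul_rearr_le_of_ρ_eq
    (hY : ∀ f, Y.ρ f = ⨆ (w : EuclideanSpace ℝ (Fin n) → ℝ≥0∞)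
      (_ : AEMeasurable w volume) (_ : assocFormula Φ E w ≤ 1),
        ∫⁻ t in Ioi (0 : ℝ), rearr volume f t * rearr volume w t)
    {w : EuclideanSpace ℝ (Fin n) → ℝ≥0∞} (hw : AEMeasurable w volume) {c : ℝ≥0} (hc : 0 < c)
    (hwc : assocFormula Φ E w ≤ c) (f : EuclideanSpace ℝ (Fin n) → ℝ≥0∞) :
    ∫⁻ t in Ioi (0 : ℝ), rearr volume f t * rearr volume w t ≤ c * Y.ρ f := by
  have hc' : (c : ℝ≥0∞) ≠ 0 := by simpa using hc.ne'
  have h1 : ∫⁻ t in Ioi (0 : ℝ), rearr volume f t *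
      rearr volume (fun x => ((c⁻¹ : ℝ≥0) : ℝ≥0∞) * w x) t ≤ Y.ρ f := by
    rw [hY]
    refine le_iSup_of_le _ (le_iSup_of_le (hw.const_mul _) (le_iSup_of_le ?_ le_rfl))
    rw [assocFormula_const_mul, ENNReal.coe_inv hc.ne']
    exact (mul_le_mul_right hwc _).trans (ENNReal.inv_mul_le_one _)
  rw [lintegral_mul_rearr_const_mul, ENNReal.coe_inv hc.ne'] at h1
  calc _ = (c : ℝ≥0∞) * ((c : ℝ≥0∞)⁻¹ *
        ∫⁻ t in Ioi (0 : ℝ), rearr volume f t * rearr volume w t) := by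
        rw [← mul_assoc, ENNReal.mul_inv_cancel hc' ENNReal.coe_ne_top, one_mul]
    _ ≤ _ := by gcongr

/-- No bipolar argument is needed. For `≤`, use Hardy–Littlewood and the definition of the norm of
`Y`. For `≥`, resonance with the weight `supOp Φ f / ‖f‖_E` gives functions `h` with `h*` below that
weight, and such `h` lie in the unit ball of `Y` by the very definition of the formula. -/
theorem assoc_eq_assocFormula_of_ρ_eq (hn : 1 ≤ n)
    (hY : ∀ f, Y.ρ f = ⨆ (w : EuclideanSpace ℝ (Fin n) → ℝ≥0∞)
      (_ : AEMeasurable w volume) (_ : assocFormula Φ E w ≤ 1),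
        ∫⁻ t in Ioi (0 : ℝ), rearr volume f t * rearr volume w t)
    {g : EuclideanSpace ℝ (Fin n) → ℝ≥0∞} (hg : AEMeasurable g volume) :
    Y.assoc g = assocFormula Φ E g := by
  apply le_antisymm
  · refine iSup_le fun h => iSup_le fun hh => iSup_le fun hh1 => ?_
    -- A level `b` strictly above the formula is positive, which allows rescaling even if the
    -- formula vanishes.
    refine le_of_forall_gt_imp_ge_of_dense fun b hb => ?_
    rcases eq_or_ne b ⊤ with rfl | hbt
    · exact le_top
    lift b to ℝ≥0 using hbt
    have hb0 : 0 < b := by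
      rw [← ENNReal.coe_pos]; exact bot_le.trans_lt hb
    calc ∫⁻ x, h x * g x ≤ ∫⁻ t in Ioi (0 : ℝ), rearr volume h t * rearr volume g t :=
          lintegral_mul_le_rearr hh hg
      _ ≤ b * Y.ρ h := lintegral_rearr_mul_rearr_le_of_ρ_eq hY hg hb0 hb.le h
      _ ≤ b * 1 := by gcongr
      _ = b := mul_one _
  · refine iSup_le fun f => iSup_le fun hf => iSup_le fun h0 => ?_
    have hinv : (E.norm f)⁻¹ ≠ ⊤ := ENNReal.inv_ne_top.2 h0
    rw [ENNReal.div_eq_inv_mul, ← lintegral_const_mul' _ _ hinv]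
    refine le_of_forall_lt fun a ha => ?_
    have hanti : Antitone fun τ => (E.norm f)⁻¹ * supOp Φ f τ := fun s t hst =>
      mul_le_mul_right (antitone_supOp Φ f hst) _
    simp only [mul_left_comm (E.norm f)⁻¹] at ha
    obtain ⟨h, hm, -, hle, hlt⟩ :=
      exists_rearr_le_lt_lintegral_mul hn hg (hanti.antitoneOn _) ha
    refine hlt.trans_le ?_
    simp only [mul_comm (g _)]
    refine Y.lintegral_mul_le_assoc hm.aemeasurable ?_
    rw [hY]
    refine iSup_le fun w => iSup_le fun hw => iSup_le fun hN => ?_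
    calc ∫⁻ t in Ioi (0 : ℝ), rearr volume h t * rearr volume w t
        ≤ ∫⁻ t in Ioi (0 : ℝ), (E.norm f)⁻¹ * (rearr volume w t * supOp Φ f t) := by
          refine setLIntegral_mono' measurableSet_Ioi fun t ht => ?_
          rw [mul_left_comm, mul_comm]
          exact mul_le_mul_right (hle t ht) _
      _ = (E.norm f)⁻¹ * ∫⁻ t in Ioi (0 : ℝ), rearr volume w t * supOp Φ f t :=
          lintegral_const_mul' _ _ hinv
      _ ≤ (E.norm f)⁻¹ * (1 * E.norm f) := by
          gcongr
          refine (lintegral_rearr_mul_supOp_le hf h0 w).trans ?_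
          gcongr
      _ ≤ 1 := by rw [one_mul]; exact ENNReal.inv_mul_le_one _

theorem maximalEmbeds_of_ρ_eq (hn : 1 ≤ n) (hΦ : ClassB n Φ)
    (hY : ∀ f, Y.ρ f = ⨆ (w : EuclideanSpace ℝ (Fin n) → ℝ≥0∞)
      (_ : AEMeasurable w volume) (_ : assocFormula Φ E w ≤ 1),
        ∫⁻ t in Ioi (0 : ℝ), rearr volume f t * rearr volume w t) :
    MaximalEmbeds Φ E Y := by
  obtain ⟨K, hK, hup⟩ := exists_rearr_maximalFn_le hn hΦ
  have key : ∀ f : EuclideanSpace ℝ (Fin n) → ℂ, E.Mem f →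
      Y.norm (maximalFn Φ f) ≤ K * E.norm f := by
    intro f hf
    change Y.ρ (maximalFn Φ f) ≤ _
    -- The formula ignores `f` of norm zero; for these `M_Φ f` vanishes identically.
    rcases eq_or_ne (E.norm f) 0 with h0 | h0
    · rw [RIS.norm, E.eq_zero_iff _ hf.1.enorm] at h0
      have hM : maximalFn Φ f = fun _ => 0 := by
        ext x
        rw [← nonpos_iff_eq_zero]
        refine iSup_le fun r => iSup_le fun _ => ?_
        rw [lintegral_congr_ae (ae_restrict_of_ae h0)]
        simp
      rw [hM, Y.ρ_zero]; exact bot_le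
    · rw [hY]
      refine iSup_le fun w => iSup_le fun hw => iSup_le fun hN => ?_
      calc ∫⁻ t in Ioi (0 : ℝ), rearr volume (maximalFn Φ f) t * rearr volume w t
          ≤ ∫⁻ t in Ioi (0 : ℝ), K * (rearr volume w t * supOp Φ f t) := by
            refine setLIntegral_mono' measurableSet_Ioi fun t ht => ?_
            rw [mul_left_comm, mul_comm]
            exact mul_le_mul_right (hup f hf.1 t ht) _
        _ = K * ∫⁻ t in Ioi (0 : ℝ), rearr volume w t * supOp Φ f t :=
            lintegral_const_mul' _ _ ENNReal.coe_ne_top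
        _ ≤ K * (1 * E.norm f) := by
            gcongr
            refine (lintegral_rearr_mul_supOp_le hf h0 w).trans ?_
            gcongr
        _ = _ := by rw [one_mul]
  refine ⟨?_, K, ?_⟩
  · rintro _ ⟨f, hf, rfl⟩
    exact ⟨(measurable_maximalFn Φ f).aemeasurable,
      (key f hf).trans_lt (ENNReal.mul_lt_top ENNReal.coe_lt_top hf.2)⟩
  · intro u _
    have hK0 : (K : ℝ≥0∞) ≠ 0 := by simpa using hK.ne'
    rw [mul_comm, ← ENNReal.div_le_iff hK0 ENNReal.coe_ne_top]
    refine le_iInf fun f => le_iInf fun hf => le_iInf fun hfu => ?_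
    rw [ENNReal.div_le_iff hK0 ENNReal.coe_ne_top, mul_comm, ← hfu]
    exact key f hf

end

end FracMax

/-! ### Comparison of `X₀` with the dual space. -/

open FracMax in
theorem corollary4p1 (n : ℕ) (hn : 1 ≤ n) (Φ : ℝ → ℝ) (hΦ : FracMax.ClassB n Φ)
    (E X₀ : FracMax.RIS n) (hX₀ : FracMax.IsOptimal Φ E X₀) :
    (∃ c C : ℝ≥0, 0 < c ∧ 0 < C ∧
      ∀ g : EuclideanSpace ℝ (Fin n) → ℂ, AEMeasurable g volume →
        c * FracMax.supFormula Φ E g ≤ X₀.assocNorm g ∧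
          X₀.assocNorm g ≤ C * FracMax.supFormula Φ E g) ∧
    (∃ X₁ : FracMax.RIS n, X₀.Equivalent X₁ ∧
      ∀ g : EuclideanSpace ℝ (Fin n) → ℂ, AEMeasurable g volume →
        X₁.assocNorm g = FracMax.supFormula Φ E g) := by
  obtain ⟨hemb, hopt⟩ := hX₀
  obtain ⟨A, hA, hle⟩ := assocFormula_le_assoc hn hΦ hemb
  have hA' : (A : ℝ≥0∞) ≠ 0 := by simpa using hA.ne'
  obtain ⟨Y, hY⟩ := exists_RIS_ρ_eq_iSup hn hΦ hemb
  -- The only use of minimality: `X₀ ⊆ Y` as sets, upgraded to a norm bound.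
  obtain ⟨C, hC, hYX⟩ := RIS.exists_ρ_le_of_mem_imp (hopt Y (maximalEmbeds_of_ρ_eq hn hΦ hY))
  have hYassoc : ∀ g : EuclideanSpace ℝ (Fin n) → ℂ, AEMeasurable g volume →
      Y.assocNorm g = supFormula Φ E g := fun g hg => by
    rw [Y.assocNorm_eq_assoc, assoc_eq_assocFormula_of_ρ_eq hn hY hg.enorm, supFormula_eq]
  refine ⟨⟨A⁻¹, C, by positivity, hC, fun g hg => ⟨?_, ?_⟩⟩,
    Y, ⟨A⁻¹, C, by positivity, hC, fun f hf => ⟨?_, hYX f hf⟩⟩, hYassoc⟩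
  · rw [supFormula_eq, X₀.assocNorm_eq_assoc, ENNReal.coe_inv hA.ne']
    calc (A : ℝ≥0∞)⁻¹ * assocFormula Φ E (fun x => ‖g x‖ₑ)
        ≤ (A : ℝ≥0∞)⁻¹ * (A * X₀.assoc fun x => ‖g x‖ₑ) := by gcongr; exact hle _ hg.enorm
      _ = _ := by rw [← mul_assoc, ENNReal.inv_mul_cancel hA' ENNReal.coe_ne_top, one_mul]
  · rw [← hYassoc g hg, X₀.assocNorm_eq_assoc, Y.assocNorm_eq_assoc]
    refine iSup_le fun h => iSup_le fun hh => iSup_le fun hh1 => ?_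
    have hYh : Y.ρ h ≤ C := (hYX h hh).trans (by
      calc (C : ℝ≥0∞) * X₀.ρ h ≤ C * 1 := by gcongr
        _ = C := mul_one _)
    exact (Y.lintegral_mul_le hh (ne_top_of_le_ne_top ENNReal.coe_ne_top hYh)).trans
      (mul_le_mul_left hYh _)
  -- By Lorentz–Luxemburg it suffices to test against `w` in the unit ball of `X₀'`; for these the
  -- formula is at most `A`.
  · have h1 : X₀.ρ f ≤ A * Y.ρ f := by
      refine (X₀.ρ_le_iSup_assoc hf).trans ?_
      refine iSup_le fun w => iSup_le fun hw => iSup_le fun hw1 => ?_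
      refine (lintegral_mul_le_rearr hf hw).trans ?_
      refine lintegral_rearr_mul_rearr_le_of_ρ_eq hY hw hA ?_ f
      calc assocFormula Φ E w ≤ A * X₀.assoc w := hle w hw
        _ ≤ A * 1 := by gcongr
        _ = A := mul_one _
    rw [ENNReal.coe_inv hA.ne']
    calc (A : ℝ≥0∞)⁻¹ * X₀.ρ f ≤ (A : ℝ≥0∞)⁻¹ * (A * Y.ρ f) := by gcongr
      _ = _ := by rw [← mul_assoc, ENNReal.inv_mul_cancel hA' ENNReal.coe_ne_top, one_mul]
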